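/- Let $G$ be an abelian group of order $2^n$. The entropy of a $G$-valued random variable $X$ is $H(X)=-\sum_{g\in G}P(X=g)\log P(X=g)$, with $\log$ the natural logarithm and $0\log 0=0$. For $k\ge 2$ and $x_1,\dots,x_k\in[0,n\log 2]$ let $$f_{G,k}(x_1,\dots,x_k)=\min H(X_1+X_2+\dots+X_k),$$ where the minimum is over all mutually independent $G$-valued random variables $X_1,\dots,X_k$ with $H(X_i)=x_i$ for $1\le i\le k$, and let $f_G=f_{G,2}$. Then for every $k\ge 2$ and all $x_1,\dots,x_k\in[0,n\log 2]$ this minimum is attained, and $$f_{G,k}(x_1,\dots,x_k)=f_G\bigl(x_1,f_G\bigl(x_2,\dots,f_G(x_{k-1},x_k)\dots\bigr)\bigr).$$ -/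

import Mathlib

open MeasureTheory ProbabilityTheory

universe u v

noncomputable section

/-- The Shannon entropy (in nats) `H(X) = -∑ g, P(X = g) log P(X = g)` of a random variable `X`
with values in a finite set, with the convention `0 log 0 = 0`. -/
def shannonEntropy {G : Type u} [Fintype G] {Ω : Type v} [MeasurableSpace Ω]
    (μ : Measure Ω) (X : Ω → G) : ℝ :=
  ∑ g : G, Real.negMulLog (μ.real (X ⁻¹' {g}))

/-- The set of all values `H(X₁ + ⋯ + X_k)`, where `X₁, …, X_k` range over the (mutually)
independent `G`-valued random variables, on any probability space, with `H(X_i) = x_i`. -/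
def sumEntropies (G : Type u) [AddCommGroup G] [Fintype G] [MeasurableSpace G]
    {k : ℕ} (x : Fin k → ℝ) : Set ℝ :=
  {h | ∃ (Ω : Type v) (_ : MeasurableSpace Ω) (μ : Measure Ω) (X : Fin k → Ω → G),
    IsProbabilityMeasure μ ∧ (∀ i, Measurable (X i)) ∧ iIndepFun X μ ∧
    (∀ i, shannonEntropy μ (X i) = x i) ∧
    h = shannonEntropy μ (fun ω => ∑ i, X i ω)}

/-- `f_{G,k}(x₁, …, x_k)`: the minimum of `H(X₁ + ⋯ + X_k)` over independent `G`-valued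
`X_i` with `H(X_i) = x_i`. It is written as an infimum; the theorem asserts that it is attained. -/
def minSumEntropy (G : Type u) [AddCommGroup G] [Fintype G] [MeasurableSpace G]
    {k : ℕ} (x : Fin k → ℝ) : ℝ :=
  sInf (sumEntropies.{u, v} G x)

/-- `f_G(x, y) = f_{G,2}(x, y)`. -/
def minSumEntropyTwo (G : Type u) [AddCommGroup G] [Fintype G] [MeasurableSpace G]
    (x y : ℝ) : ℝ :=
  minSumEntropy.{u, v} G ![x, y]

/-- `f (x₁, f (x₂, … f (x_{k-1}, x_k) …))`, which is `x₁` for `k = 1` (and, by convention, `0`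
for the empty family). -/
def nested (f : ℝ → ℝ → ℝ) : (k : ℕ) → (Fin k → ℝ) → ℝ
  | 0, _ => 0
  | 1, x => x 0
  | k + 2, x => f (x 0) (nested f (k + 1) (fun i => x i.succ))

end

/-!
Let `L = log 2`. For two independent bits the minimal entropy of the sum with given entropies is
`binarySum`: if a bit of bias `α` has entropy `biasEntropy α`, then the sum of independent bits of
biases `α` and `β` has bias `α * β`. In a group of order `2 ^ n` the minimum turns out to be
`dyadicSum x y`, which is `binarySum` shifted by `k L` when `x` and `y` both lie in
`[k L, (k + 1) L]`, and `max x y` otherwise.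

*Upper bound.* Fix a chain of subgroups `K 0 < K 1 < ⋯ < K n`, each of index two in the next. A
mixture of the uniform laws on the two cosets of `K k` in `K (k + 1)` can have any entropy in
`[k L, (k + 1) L]`. These `extremalLaws` are closed under convolution and the entropies compose by
`dyadicSum` (`DyadicChain.conv_mem_extremalLaws`). So a sum of independent extremal variables has
exactly the nested entropy. The closure is what makes the nested formula work: the minimal sum of
all variables but the first can be used again as a summand.

*Lower bound.* `DyadicChain.dyadicSum_le_vecEntropy_conv` is proved by induction along the chain.
Conditioning both summands on their coset of `K i` in `K (i + 1)` and using concavity of the entropy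
bounds `H(X + Y)` below by the `binarySum` of the entropies of the two coset bits plus an average of
`dyadicSum`s of conditional entropies. This suffices because `dyadicSum` is convex in each variable
(`dyadicSum_jensen`) and satisfies `dyadicSum (a + u) (b + v) ≤ binarySum a b + dyadicSum u v` for
`a, b ∈ [0, L]` (`dyadicSum_add_le`). For more than two variables the bound is
iterated, using that `dyadicSum` is monotone.

*Analysis.* Convexity is Mrs. Gerber's lemma (`biasEntropy_mul_supporting_line`). The inequality
`dyadicSum_add_le` reduces to the subadditivity of `binarySum` and to the superadditivity of its
deficit from `L`. For the former, given the target point `(x, y)`, there is a linear function that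
agrees with `binarySum` at `(x, y)` and lies below it on the whole box `[0, x] × [0, y]`; adding
its values at two points with sum `(x, y)` gives the claim. On the two edges of the box through
`(x, y)` the bound follows from convexity, on the other two from slopes at most `1`. At an interior
critical point of the difference it says that
`biasEntropy α / (α * artanh α)` is superadditive in `-log α` (`biasEntropy_div_add_le`), which
follows from the monotonicity of `biasEntropy α / (-log α * (α * artanh α))`. The deficit is handled
in the same way (`le_log_two_sub_biasEntropy_div_add`).
-/

open Real Set

/-! ### The binary entropy as a function of the bias -/

/-- The entropy of a bit whose two values have probabilities `(1 ± α) / 2`. In terms of the bias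
`α`, adding independent bits multiplies the biases. -/
noncomputable def biasEntropy (α : ℝ) : ℝ := binEntropy ((1 - α) / 2)

lemma biasEntropy_zero : biasEntropy 0 = log 2 := by
  have : ((1 : ℝ) - 0) / 2 = 2⁻¹ := by norm_num
  rw [biasEntropy, this, binEntropy_two_inv]

lemma biasEntropy_one : biasEntropy 1 = 0 := by simp [biasEntropy]

lemma biasEntropy_neg (α : ℝ) : biasEntropy (-α) = biasEntropy α := by
  rw [biasEntropy, biasEntropy, ← binEntropy_one_sub]
  congr 1
  ring

lemma biasEntropy_abs (α : ℝ) : biasEntropy |α| = biasEntropy α := by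
  rcases abs_choice α with h | h <;> rw [h]
  exact biasEntropy_neg α

lemma biasEntropy_nonneg {α : ℝ} (h0 : -1 ≤ α) (h1 : α ≤ 1) : 0 ≤ biasEntropy α :=
  binEntropy_nonneg (by linarith) (by linarith)

lemma biasEntropy_le_log_two (α : ℝ) : biasEntropy α ≤ log 2 := binEntropy_le_log_two

lemma continuous_biasEntropy : Continuous biasEntropy := by
  unfold biasEntropy
  fun_prop

lemma biasEntropy_strictAntiOn : StrictAntiOn biasEntropy (Icc 0 1) := by
  intro a ha b hb hab
  exact binEntropy_strictMonoOn (by constructor <;> linarith [hb.1, hb.2])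
    (by constructor <;> linarith [ha.1, ha.2]) (by linarith)

lemma exists_biasEntropy_eq {x : ℝ} (h0 : 0 ≤ x) (h1 : x ≤ log 2) :
    ∃ α ∈ Icc (0 : ℝ) 1, biasEntropy α = x := by
  have h := intermediate_value_Icc' (zero_le_one' ℝ) continuous_biasEntropy.continuousOn
  rw [biasEntropy_zero, biasEntropy_one] at h
  exact h ⟨h0, h1⟩

lemma artanh_eq_half_sub {α : ℝ} (h0 : -1 < α) (h1 : α < 1) :
    artanh α = (log (1 + α) - log (1 - α)) / 2 := by
  rw [artanh_eq_half_log ⟨h0.le, h1.le⟩, log_div (by linarith) (by linarith)]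
  ring

lemma hasDerivAt_artanh {α : ℝ} (h0 : -1 < α) (h1 : α < 1) :
    HasDerivAt artanh (1 / (1 - α ^ 2)) α := by
  have hp : 1 + α ≠ 0 := by linarith
  have hm : 1 - α ≠ 0 := by linarith
  have h : HasDerivAt (fun y : ℝ => (log (1 + y) - log (1 - y)) / 2)
      ((1 / (1 + α) - -1 / (1 - α)) / 2) α :=
    ((((hasDerivAt_id α).const_add 1).log hp).sub
      (((hasDerivAt_id α).const_sub 1).log hm)).div_const 2
  have he : (1 / (1 + α) - -1 / (1 - α)) / 2 = 1 / (1 - α ^ 2) := by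
    have : 1 - α ^ 2 = (1 + α) * (1 - α) := by ring
    rw [this]
    field_simp
    ring
  rw [← he]
  refine h.congr_of_eventuallyEq ?_
  filter_upwards [Ioo_mem_nhds h0 h1] with y hy
  exact artanh_eq_half_sub hy.1 hy.2

lemma hasDerivAt_biasEntropy {α : ℝ} (h0 : -1 < α) (h1 : α < 1) :
    HasDerivAt biasEntropy (-artanh α) α := by
  have h := (hasDerivAt_binEntropy (p := (1 - α) / 2) (by linarith) (by linarith)).comp α
    (((hasDerivAt_id α).const_sub 1).div_const 2)
  have e1 : 1 - (1 - α) / 2 = (1 + α) / 2 := by ring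
  have e2 : (log (1 - (1 - α) / 2) - log ((1 - α) / 2)) * (-1 / 2) = -artanh α := by
    rw [artanh_eq_half_sub h0 h1, e1, log_div (by linarith) two_ne_zero,
      log_div (by linarith) two_ne_zero]
    ring
  exact e2 ▸ h

lemma biasEntropy_eq {α : ℝ} (h0 : -1 < α) (h1 : α < 1) :
    biasEntropy α = (1 - α) * artanh α + log 2 - log (1 + α) := by
  have e1 : 1 - (1 - α) / 2 = (1 + α) / 2 := by ring
  rw [artanh_eq_half_sub h0 h1, biasEntropy, binEntropy, e1, log_inv, log_inv,
    log_div (by linarith) two_ne_zero, log_div (by linarith) two_ne_zero]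
  ring

lemma self_le_artanh {α : ℝ} (h0 : 0 ≤ α) (h1 : α < 1) : α ≤ artanh α := by
  have h : MonotoneOn (fun y => artanh y - y) (Ico 0 1) := by
    refine monotoneOn_of_hasDerivWithinAt_nonneg (f' := fun y => 1 / (1 - y ^ 2) - 1)
      (convex_Ico 0 1) ?_ ?_ ?_
    · intro y hy
      exact ((hasDerivAt_artanh (by linarith [hy.1]) hy.2).continuousAt.sub
        continuousAt_id).continuousWithinAt
    · intro y hy
      rw [interior_Ico] at hy
      exact ((hasDerivAt_artanh (by linarith [hy.1]) hy.2).sub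
        (hasDerivAt_id y)).hasDerivWithinAt
    · intro y hy
      rw [interior_Ico] at hy
      rw [sub_nonneg, le_div_iff₀ (by nlinarith [hy.1, hy.2])]
      nlinarith [hy.1]
  have := h ⟨le_rfl, one_pos⟩ ⟨h0, h1⟩ h0
  simp only [artanh_zero, sub_zero] at this
  linarith

/-- Equivalently, the logarithmic derivative `α / ((1 - α ^ 2) * artanh α)` of `artanh` with respect
to `log α` is increasing. -/
lemma one_sub_sq_mul_artanh_div_antitoneOn :
    AntitoneOn (fun α => (1 - α ^ 2) * artanh α / α) (Ioo 0 1) := by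
  have hd : ∀ y ∈ Ioo (0 : ℝ) 1, HasDerivAt (fun α => (1 - α ^ 2) * artanh α / α)
      (((-(2 * y) * artanh y + (1 - y ^ 2) * (1 / (1 - y ^ 2))) * y -
        (1 - y ^ 2) * artanh y * 1) / y ^ 2) y := by
    intro y hy
    have h1 : HasDerivAt (fun α : ℝ => 1 - α ^ 2) (-(2 * y)) y := by
      simpa using (hasDerivAt_pow 2 y).const_sub 1
    exact (h1.mul (hasDerivAt_artanh (by linarith [hy.1]) hy.2)).div (hasDerivAt_id y) hy.1.ne'
  refine antitoneOn_of_hasDerivWithinAt_nonpos (convex_Ioo 0 1)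
    (fun y hy => (hd y hy).continuousAt.continuousWithinAt)
    (fun y hy => (hd y (interior_subset hy)).hasDerivWithinAt) ?_
  intro y hy
  have hy := interior_subset hy
  have hw : 1 - y ^ 2 ≠ 0 := by nlinarith [hy.1, hy.2]
  apply div_nonpos_of_nonpos_of_nonneg _ (sq_nonneg y)
  rw [mul_one_div_cancel hw]
  nlinarith [self_le_artanh hy.1.le hy.2, mul_nonneg (sq_nonneg y) (artanh_nonneg hy.1.le)]

/-- The slope `β * artanh (α * β) / artanh α` of `biasEntropy (α * β)` with respect to
`biasEntropy α` decreases in `α`: this is the convexity expressed by Mrs. Gerber's lemma. -/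
lemma artanh_mul_div_artanh_antitoneOn {β : ℝ} (h0 : 0 < β) (h1 : β < 1) :
    AntitoneOn (fun α => artanh (α * β) / artanh α) (Ioo 0 1) := by
  have hm : ∀ y ∈ Ioo (0 : ℝ) 1, y * β ∈ Ioo (0 : ℝ) 1 := fun y hy =>
    ⟨mul_pos hy.1 h0, by nlinarith [hy.1, hy.2]⟩
  have hd : ∀ y ∈ Ioo (0 : ℝ) 1, HasDerivAt (fun α => artanh (α * β) / artanh α)
      ((1 / (1 - (y * β) ^ 2) * (1 * β) * artanh y - artanh (y * β) * (1 / (1 - y ^ 2))) /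
        artanh y ^ 2) y := by
    intro y hy
    have h2 := hm y hy
    exact ((hasDerivAt_artanh (by linarith [h2.1]) h2.2).comp y
      ((hasDerivAt_id y).mul_const β)).div (hasDerivAt_artanh (by linarith [hy.1]) hy.2)
      (artanh_pos hy).ne'
  refine antitoneOn_of_hasDerivWithinAt_nonpos (convex_Ioo 0 1)
    (fun y hy => (hd y hy).continuousAt.continuousWithinAt)
    (fun y hy => (hd y (interior_subset hy)).hasDerivWithinAt) ?_
  intro y hy
  have hy := interior_subset hy
  have h2 := hm y hy
  apply div_nonpos_of_nonpos_of_nonneg _ (sq_nonneg _)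
  have hw : 0 < 1 - y ^ 2 := by nlinarith [hy.1, hy.2]
  have hw2 : 0 < 1 - (y * β) ^ 2 := by nlinarith [h2.1, h2.2]
  have h := one_sub_sq_mul_artanh_div_antitoneOn h2 hy (by nlinarith [hy.1])
  simp only at h
  rw [div_le_div_iff₀ hy.1 h2.1] at h
  have h' : (1 - y ^ 2) * artanh y * β ≤ (1 - (y * β) ^ 2) * artanh (y * β) := by
    refine le_of_mul_le_mul_right ?_ hy.1
    linarith
  rw [sub_nonpos, one_div_mul_eq_div, mul_one_div, div_mul_eq_mul_div, div_le_div_iff₀ hw2 hw]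
  linarith

lemma artanh_mul_mul_artanh_le {α α' β : ℝ} (h0 : 0 < α) (h : α ≤ α') (h1 : α' < 1)
    (hβ0 : 0 < β) (hβ1 : β < 1) :
    artanh (α' * β) * artanh α ≤ artanh (α * β) * artanh α' := by
  have := artanh_mul_div_artanh_antitoneOn hβ0 hβ1 (⟨h0, by linarith⟩ : α ∈ Ioo 0 1)
    (⟨by linarith, h1⟩ : α' ∈ Ioo 0 1) h
  simp only at this
  rwa [div_le_div_iff₀ (artanh_pos ⟨by linarith, h1⟩) (artanh_pos ⟨h0, by linarith⟩)] at this

lemma biasEntropy_le {α : ℝ} (h0 : 0 < α) (h1 : α < 1) :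
    biasEntropy α ≤ (1 - α) * (artanh α + 1 / (1 + α)) := by
  rw [biasEntropy_eq (by linarith) h1]
  have h := log_le_sub_one_of_pos (show 0 < 2 / (1 + α) by positivity)
  rw [log_div two_ne_zero (by linarith)] at h
  have e : 2 / (1 + α) - 1 = (1 - α) * (1 / (1 + α)) := by
    field_simp
    ring
  linarith

/-- The entropy deficit is at most half of `α * artanh α`, which is its leading term at `0`. -/
lemma log_two_sub_biasEntropy_le {α : ℝ} (h0 : 0 ≤ α) (h1 : α < 1) :
    log 2 - biasEntropy α ≤ α * artanh α / 2 := by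
  have hd : ∀ y ∈ Ico (0 : ℝ) 1, HasDerivAt (fun y => y * artanh y / 2 + biasEntropy y)
      ((1 * artanh y + y * (1 / (1 - y ^ 2))) / 2 + -artanh y) y := by
    intro y hy
    exact (((hasDerivAt_id y).mul (hasDerivAt_artanh (by linarith [hy.1]) hy.2)).div_const 2).add
      (hasDerivAt_biasEntropy (by linarith [hy.1]) hy.2)
  have h : MonotoneOn (fun y => y * artanh y / 2 + biasEntropy y) (Ico 0 1) := by
    refine monotoneOn_of_hasDerivWithinAt_nonneg (convex_Ico 0 1)
      (fun y hy => (hd y hy).continuousAt.continuousWithinAt)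
      (fun y hy => (hd y (interior_subset hy)).hasDerivWithinAt) ?_
    intro y hy
    rw [interior_Ico] at hy
    have hw : 0 < 1 - y ^ 2 := by nlinarith [hy.1, hy.2]
    have ht : artanh y ≤ y / (1 - y ^ 2) := by
      have hg : MonotoneOn (fun y => y / (1 - y ^ 2) - artanh y) (Ico 0 1) := by
        have hd' : ∀ y ∈ Ico (0 : ℝ) 1, HasDerivAt (fun y => y / (1 - y ^ 2) - artanh y)
            ((1 * (1 - y ^ 2) - y * (-(2 * y))) / (1 - y ^ 2) ^ 2 - 1 / (1 - y ^ 2)) y := by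
          intro y hy
          have h1 : HasDerivAt (fun α : ℝ => 1 - α ^ 2) (-(2 * y)) y := by
            simpa using (hasDerivAt_pow 2 y).const_sub 1
          exact ((hasDerivAt_id y).div h1 (by nlinarith [hy.1, hy.2])).sub
            (hasDerivAt_artanh (by linarith [hy.1]) hy.2)
        refine monotoneOn_of_hasDerivWithinAt_nonneg (convex_Ico 0 1)
          (fun y hy => (hd' y hy).continuousAt.continuousWithinAt)
          (fun y hy => (hd' y (interior_subset hy)).hasDerivWithinAt) ?_
        intro z hz
        have hz := interior_subset hz
        have hw : 0 < 1 - z ^ 2 := by nlinarith [hz.1, hz.2]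
        rw [sub_nonneg, div_le_div_iff₀ hw (by positivity)]
        nlinarith [mul_nonneg (sq_nonneg z) hw.le]
      have := hg ⟨le_rfl, one_pos⟩ ⟨hy.1.le, hy.2⟩ hy.1.le
      simp only [artanh_zero, zero_div, sub_zero] at this
      linarith
    rw [mul_one_div]
    linarith
  have := h ⟨le_rfl, one_pos⟩ ⟨h0, h1⟩ h0
  simp only [biasEntropy_zero, zero_mul, zero_div] at this
  linarith

lemma hasDerivAt_neg_log_mul_mul_artanh {y : ℝ} (hy : y ∈ Ioo (0 : ℝ) 1) :
    HasDerivAt (fun α => -log α * (α * artanh α))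
      (-artanh y + -log y * (artanh y + y / (1 - y ^ 2))) y := by
  have h := (hasDerivAt_log hy.1.ne').neg.mul
    ((hasDerivAt_id y).mul (hasDerivAt_artanh (by linarith [hy.1]) hy.2))
  have e : -y⁻¹ * (y * artanh y) + -log y * (1 * artanh y + y * (1 / (1 - y ^ 2))) =
      -artanh y + -log y * (artanh y + y / (1 - y ^ 2)) := by
    rw [neg_mul, inv_mul_cancel_left₀ hy.1.ne']
    ring
  exact e ▸ h

lemma neg_log_mul_mul_artanh_pos {y : ℝ} (hy : y ∈ Ioo (0 : ℝ) 1) :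
    0 < -log y * (y * artanh y) :=
  mul_pos (neg_pos.2 (log_neg hy.1 hy.2)) (mul_pos hy.1 (artanh_pos hy))

/-- The sign of the derivative follows from `1 - α ≤ -log α` and `biasEntropy_le`. -/
lemma biasEntropy_div_antitoneOn :
    AntitoneOn (fun α => biasEntropy α / (-log α * (α * artanh α))) (Ioo 0 1) := by
  have hd : ∀ y ∈ Ioo (0 : ℝ) 1,
      HasDerivAt (fun α => biasEntropy α / (-log α * (α * artanh α))) _ y := fun y hy =>
    (hasDerivAt_biasEntropy (by linarith [hy.1]) hy.2).div (hasDerivAt_neg_log_mul_mul_artanh hy)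
      (neg_log_mul_mul_artanh_pos hy).ne'
  refine antitoneOn_of_hasDerivWithinAt_nonpos (convex_Ioo 0 1)
    (fun y hy => (hd y hy).continuousAt.continuousWithinAt)
    (fun y hy => (hd y (interior_subset hy)).hasDerivWithinAt) ?_
  intro y hy
  have hy := interior_subset hy
  apply div_nonpos_of_nonpos_of_nonneg _ (sq_nonneg _)
  have ht := artanh_pos hy
  have hφ := biasEntropy_le hy.1 hy.2
  have hφ0 := biasEntropy_nonneg (by linarith [hy.1]) hy.2.le
  have hl : 1 - y ≤ -log y := by linarith [log_le_sub_one_of_pos hy.1]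
  obtain ⟨h0, h1⟩ := hy
  have hw : y / (1 - y ^ 2) = y * (1 / (1 + y)) / (1 - y) := by
    have : 1 - y ≠ 0 := by linarith
    have h2 : 1 - y ^ 2 = (1 + y) * (1 - y) := by ring
    rw [h2]
    field_simp
  set t := artanh y
  set φ := biasEntropy y
  set l := -log y
  set c := 1 / (1 + y)
  have hc : 0 < c := by positivity
  have hq : 0 ≤ y * c / (1 - y) := by
    have : 0 < 1 - y := by linarith
    positivity
  rw [hw]
  -- The terms with `l` have a nonnegative coefficient, so `l` can be replaced by `1 - y`.
  have hX : 0 ≤ y * t ^ 2 + φ * t + φ * (y * c / (1 - y)) := by positivity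
  have key : φ * t ≤ (1 - y) * (y * t ^ 2 + φ * t + φ * (y * c / (1 - y))) := by
    have e : (1 - y) * (φ * (y * c / (1 - y))) = φ * (y * c) := by
      have : 1 - y ≠ 0 := by linarith
      field_simp
    have h3 : φ * (t - c) ≤ (1 - y) * t ^ 2 := by
      have : 0 ≤ (1 - y) * t ^ 2 := by
        have : 0 < 1 - y := by linarith
        positivity
      rcases le_total t c with h | h
      · nlinarith
      · have h4 := mul_le_mul_of_nonneg_right hφ (sub_nonneg.2 h)
        have : 0 ≤ (1 - y) * c ^ 2 := by
          have : 0 < 1 - y := by linarith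
          positivity
        nlinarith
    have h5 := mul_le_mul_of_nonneg_left h3 h0.le
    nlinarith
  have := mul_le_mul_of_nonneg_right hl hX
  nlinarith

/-- The sign of the derivative follows from `-log α ≤ (1 - α) / α` and
`log_two_sub_biasEntropy_le`, whose constant `1 / 2` cannot be weakened here. -/
lemma log_two_sub_biasEntropy_div_monotoneOn :
    MonotoneOn (fun α => (log 2 - biasEntropy α) / (-log α * (α * artanh α))) (Ioo 0 1) := by
  have hd : ∀ y ∈ Ioo (0 : ℝ) 1,
      HasDerivAt (fun α => (log 2 - biasEntropy α) / (-log α * (α * artanh α))) _ y := fun y hy =>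
    ((hasDerivAt_biasEntropy (by linarith [hy.1]) hy.2).const_sub _).div
      (hasDerivAt_neg_log_mul_mul_artanh hy) (neg_log_mul_mul_artanh_pos hy).ne'
  refine monotoneOn_of_hasDerivWithinAt_nonneg (convex_Ioo 0 1)
    (fun y hy => (hd y hy).continuousAt.continuousWithinAt)
    (fun y hy => (hd y (interior_subset hy)).hasDerivWithinAt) ?_
  intro y hy
  have hy := interior_subset hy
  apply div_nonneg _ (sq_nonneg _)
  have ht := artanh_pos hy
  have hty := self_le_artanh hy.1.le hy.2
  have hκ := log_two_sub_biasEntropy_le hy.1.le hy.2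
  have hκ0 : 0 ≤ log 2 - biasEntropy y := by linarith [biasEntropy_le_log_two y]
  have hl0 : 0 < -log y := neg_pos.2 (log_neg hy.1 hy.2)
  have hl : -log y * y ≤ 1 - y := by
    have := log_le_sub_one_of_pos (inv_pos.2 hy.1)
    rw [log_inv] at this
    calc -log y * y ≤ (y⁻¹ - 1) * y := mul_le_mul_of_nonneg_right this hy.1.le
      _ = 1 - y := by rw [sub_mul, inv_mul_cancel₀ hy.1.ne', one_mul]
  obtain ⟨h0, h1⟩ := hy
  set t := artanh y
  set κ := log 2 - biasEntropy y
  set l := -log y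
  have hw : 0 < 1 - y ^ 2 := by nlinarith
  have hB : -t + l * (t + y / (1 - y ^ 2)) ≤ 2 * (l * t) := by
    have h2 : l * (y / (1 - y ^ 2)) ≤ t + l * t := by
      have h3 : l * y ≤ (t + l * t) * (1 - y ^ 2) := by
        have h4 : y * (l * y) ≤ y * (1 - y) := mul_le_mul_of_nonneg_left hl h0.le
        have h5 : l * y * (1 - y ^ 2) ≤ l * t * (1 - y ^ 2) := by gcongr
        have h6 : y * (1 - y ^ 2) ≤ t * (1 - y ^ 2) := by gcongr
        nlinarith
      rw [mul_div_assoc', div_le_iff₀ hw]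
      exact h3
    linarith
  rw [neg_neg, sub_nonneg]
  rcases le_total (-t + l * (t + y / (1 - y ^ 2))) 0 with h | h
  · have : 0 ≤ t * (l * (y * t)) := by positivity
    nlinarith
  · calc κ * (-t + l * (t + y / (1 - y ^ 2)))
        ≤ (y * t / 2) * (2 * (l * t)) := mul_le_mul hκ hB h (by positivity)
      _ = t * (l * (y * t)) := by ring

/-- The ratio `biasEntropy α / (α * artanh α)` is superadditive as a function of `-log α`. -/
lemma biasEntropy_div_add_le {α β : ℝ} (hα : α ∈ Ioo (0 : ℝ) 1) (hβ : β ∈ Ioo (0 : ℝ) 1) :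
    biasEntropy α / (α * artanh α) + biasEntropy β / (β * artanh β) ≤
      biasEntropy (α * β) / (α * β * artanh (α * β)) := by
  have hm : α * β ∈ Ioo (0 : ℝ) 1 :=
    ⟨mul_pos hα.1 hβ.1, by nlinarith [hα.1, hα.2, hβ.1, hβ.2]⟩
  have e : ∀ y ∈ Ioo (0 : ℝ) 1, biasEntropy y / (y * artanh y) =
      biasEntropy y / (-log y * (y * artanh y)) * -log y := by
    intro y hy
    have h1 : -log y ≠ 0 := (neg_pos.2 (log_neg hy.1 hy.2)).ne'
    rw [div_mul_eq_mul_div, mul_comm _ (-log y), mul_div_mul_left _ _ h1]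
  have hl : ∀ r : ℝ, r * -log (α * β) = r * -log α + r * -log β := by
    intro r
    rw [log_mul hα.1.ne' hβ.1.ne']
    ring
  rw [e α hα, e β hβ, e _ hm, hl]
  have h1 := biasEntropy_div_antitoneOn hm hα (by nlinarith [hα.1, hβ.2])
  have h2 := biasEntropy_div_antitoneOn hm hβ (by nlinarith [hα.2, hβ.1])
  have := mul_le_mul_of_nonneg_right h1 (neg_pos.2 (log_neg hα.1 hα.2)).le
  have := mul_le_mul_of_nonneg_right h2 (neg_pos.2 (log_neg hβ.1 hβ.2)).le
  linarith

/-- The ratio `(log 2 - biasEntropy α) / (α * artanh α)` is subadditive as a function of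
`-log α`. -/
lemma le_log_two_sub_biasEntropy_div_add {α β : ℝ} (hα : α ∈ Ioo (0 : ℝ) 1)
    (hβ : β ∈ Ioo (0 : ℝ) 1) :
    (log 2 - biasEntropy (α * β)) / (α * β * artanh (α * β)) ≤
      (log 2 - biasEntropy α) / (α * artanh α) + (log 2 - biasEntropy β) / (β * artanh β) := by
  have hm : α * β ∈ Ioo (0 : ℝ) 1 :=
    ⟨mul_pos hα.1 hβ.1, by nlinarith [hα.1, hα.2, hβ.1, hβ.2]⟩
  have e : ∀ y ∈ Ioo (0 : ℝ) 1, (log 2 - biasEntropy y) / (y * artanh y) =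
      (log 2 - biasEntropy y) / (-log y * (y * artanh y)) * -log y := by
    intro y hy
    have h1 : -log y ≠ 0 := (neg_pos.2 (log_neg hy.1 hy.2)).ne'
    rw [div_mul_eq_mul_div, mul_comm _ (-log y), mul_div_mul_left _ _ h1]
  have hl : ∀ r : ℝ, r * -log (α * β) = r * -log α + r * -log β := by
    intro r
    rw [log_mul hα.1.ne' hβ.1.ne']
    ring
  rw [e α hα, e β hβ, e _ hm, hl]
  have h1 := log_two_sub_biasEntropy_div_monotoneOn hm hα (by nlinarith [hα.1, hβ.2])
  have h2 := log_two_sub_biasEntropy_div_monotoneOn hm hβ (by nlinarith [hα.2, hβ.1])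
  have := mul_le_mul_of_nonneg_right h1 (neg_pos.2 (log_neg hα.1 hα.2)).le
  have := mul_le_mul_of_nonneg_right h2 (neg_pos.2 (log_neg hβ.1 hβ.2)).le
  linarith

/-! ### Subadditivity of the binary sum entropy -/

lemma hasDerivAt_biasEntropy_mul_sub {α β : ℝ} (c : ℝ) (hα : α ∈ Ioo (0 : ℝ) 1)
    (hβ : β ∈ Ioo (0 : ℝ) 1) :
    HasDerivAt (fun a => biasEntropy (a * β) - c * biasEntropy a)
      (c * artanh α - β * artanh (α * β)) α := by
  have hm : α * β ∈ Ioo (0 : ℝ) 1 :=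
    ⟨mul_pos hα.1 hβ.1, by nlinarith [hα.1, hα.2, hβ.1, hβ.2]⟩
  have h := ((hasDerivAt_biasEntropy (by linarith [hm.1]) hm.2).comp α
    ((hasDerivAt_id α).mul_const β)).sub
    ((hasDerivAt_biasEntropy (by linarith [hα.1]) hα.2).const_mul c)
  have e : -artanh (α * β) * (1 * β) - c * -artanh α = c * artanh α - β * artanh (α * β) := by
    ring
  exact e ▸ h

lemma continuous_biasEntropy_mul_sub (β c : ℝ) :
    Continuous fun a => biasEntropy (a * β) - c * biasEntropy a := by
  have := continuous_biasEntropy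
  fun_prop

lemma biasEntropy_mul_sub_monotoneOn {α₀ β c : ℝ} (hα : α₀ ∈ Ioo (0 : ℝ) 1)
    (hβ : β ∈ Ioo (0 : ℝ) 1) (hc : β * artanh (α₀ * β) / artanh α₀ ≤ c) :
    MonotoneOn (fun a => biasEntropy (a * β) - c * biasEntropy a) (Icc α₀ 1) := by
  refine monotoneOn_of_hasDerivWithinAt_nonneg (f' := fun a => c * artanh a - β * artanh (a * β))
    (convex_Icc _ _) (continuous_biasEntropy_mul_sub β c).continuousOn ?_ ?_ <;>
    intro y hy <;> rw [interior_Icc] at hy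
  · exact (hasDerivAt_biasEntropy_mul_sub c ⟨hα.1.trans hy.1, hy.2⟩ hβ).hasDerivWithinAt
  · have h := artanh_mul_mul_artanh_le hα.1 hy.1.le hy.2 hβ.1 hβ.2
    have h0 := artanh_pos hα
    have h1 := artanh_pos ⟨hα.1.trans hy.1, hy.2⟩
    rw [div_le_iff₀ h0] at hc
    rw [sub_nonneg]
    refine le_of_mul_le_mul_right ?_ h0
    have h2 := mul_le_mul_of_nonneg_left h hβ.1.le
    have h3 := mul_le_mul_of_nonneg_right hc h1.le
    linarith

lemma biasEntropy_mul_sub_antitoneOn {α₀ β c : ℝ} (hα : α₀ ∈ Ioo (0 : ℝ) 1)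
    (hβ : β ∈ Ioo (0 : ℝ) 1) (hc : c ≤ β * artanh (α₀ * β) / artanh α₀) :
    AntitoneOn (fun a => biasEntropy (a * β) - c * biasEntropy a) (Icc 0 α₀) := by
  refine antitoneOn_of_hasDerivWithinAt_nonpos (f' := fun a => c * artanh a - β * artanh (a * β))
    (convex_Icc _ _) (continuous_biasEntropy_mul_sub β c).continuousOn ?_ ?_ <;>
    intro y hy <;> rw [interior_Icc] at hy
  · exact (hasDerivAt_biasEntropy_mul_sub c ⟨hy.1, hy.2.trans hα.2⟩ hβ).hasDerivWithinAt
  · have h := artanh_mul_mul_artanh_le hy.1 hy.2.le hα.2 hβ.1 hβ.2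
    have h0 := artanh_pos hα
    have h1 := artanh_pos ⟨hy.1, hy.2.trans hα.2⟩
    rw [le_div_iff₀ h0] at hc
    rw [sub_nonpos]
    refine le_of_mul_le_mul_right ?_ h0
    have h2 := mul_le_mul_of_nonneg_left h hβ.1.le
    have h3 := mul_le_mul_of_nonneg_right hc h1.le
    linarith

/-- Mrs. Gerber's lemma: `biasEntropy (α * β)` is a convex function of `biasEntropy α`. It is
expressed here through the supporting line at `α₀`. -/
lemma biasEntropy_mul_supporting_line {α₀ β α : ℝ} (hα₀ : α₀ ∈ Ioo (0 : ℝ) 1)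
    (hβ : β ∈ Ioo (0 : ℝ) 1) (hα : α ∈ Icc (0 : ℝ) 1) :
    biasEntropy (α₀ * β) +
        β * artanh (α₀ * β) / artanh α₀ * (biasEntropy α - biasEntropy α₀) ≤
      biasEntropy (α * β) := by
  rcases le_total α α₀ with h | h
  · have := biasEntropy_mul_sub_antitoneOn hα₀ hβ le_rfl ⟨hα.1, h⟩ ⟨hα₀.1.le, le_rfl⟩ h
    simp only at this
    linarith
  · have := biasEntropy_mul_sub_monotoneOn hα₀ hβ le_rfl ⟨le_rfl, hα₀.2.le⟩ ⟨h, hα.2⟩ h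
    simp only at this
    linarith

lemma slope_mem_Icc {α β : ℝ} (hα : α ∈ Ioo (0 : ℝ) 1) (hβ : β ∈ Ioo (0 : ℝ) 1) :
    β * artanh (α * β) / artanh α ∈ Icc (0 : ℝ) 1 := by
  have hm : α * β ∈ Ioo (0 : ℝ) 1 :=
    ⟨mul_pos hα.1 hβ.1, by nlinarith [hα.1, hα.2, hβ.1, hβ.2]⟩
  have h0 := artanh_pos hα
  have h1 := artanh_pos hm
  have h2 := artanh_le_artanh (by linarith [hm.1]) hα.2 (show α * β ≤ α by
    nlinarith [hα.1, hβ.2])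
  refine ⟨div_nonneg (mul_nonneg hβ.1.le h1.le) h0.le, ?_⟩
  rw [div_le_one h0]
  nlinarith [hβ.1, hβ.2]

lemma biasEntropy_le_mul_right {α β : ℝ} (hα : α ∈ Icc (0 : ℝ) 1) (hβ : β ∈ Icc (0 : ℝ) 1) :
    biasEntropy α ≤ biasEntropy (α * β) :=
  biasEntropy_strictAntiOn.antitoneOn
    ⟨mul_nonneg hα.1 hβ.1, mul_le_one₀ hα.2 hβ.1 hβ.2⟩ hα
    (mul_le_of_le_one_right hα.1 hβ.2)

lemma biasEntropy_le_mul_left {α β : ℝ} (hα : α ∈ Icc (0 : ℝ) 1) (hβ : β ∈ Icc (0 : ℝ) 1) :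
    biasEntropy β ≤ biasEntropy (α * β) := mul_comm β α ▸ biasEntropy_le_mul_right hβ hα

lemma biasEntropy_mul_le_add {α β : ℝ} (hα : α ∈ Ioo (0 : ℝ) 1) (hβ : β ∈ Ioo (0 : ℝ) 1) :
    biasEntropy (α * β) ≤ biasEntropy α + biasEntropy β := by
  have := biasEntropy_mul_sub_monotoneOn hα hβ (slope_mem_Icc hα hβ).2
    ⟨le_rfl, hα.2.le⟩ ⟨hα.2.le, le_rfl⟩ hα.2.le
  simp only [biasEntropy_one, one_mul] at this
  linarith

lemma add_le_biasEntropy_mul_of_slope_eq {α β lam mu : ℝ} (hα : α ∈ Ioo (0 : ℝ) 1)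
    (hβ : β ∈ Ioo (0 : ℝ) 1) (h1 : lam * artanh α = β * artanh (α * β))
    (h2 : mu * artanh β = α * artanh (α * β)) :
    lam * biasEntropy α + mu * biasEntropy β ≤ biasEntropy (α * β) := by
  have hm : α * β ∈ Ioo (0 : ℝ) 1 :=
    ⟨mul_pos hα.1 hβ.1, by nlinarith [hα.1, hα.2, hβ.1, hβ.2]⟩
  have ha := artanh_pos hα
  have hb := artanh_pos hβ
  have h0 := mul_pos hm.1 (artanh_pos hm)
  have h := mul_le_mul_of_nonneg_left (biasEntropy_div_add_le hα hβ) h0.le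
  rw [mul_div_cancel₀ _ h0.ne'] at h
  refine le_trans (le_of_eq ?_) h
  rw [eq_div_of_mul_eq ha.ne' h1, eq_div_of_mul_eq hb.ne' h2]
  have := hα.1.ne'
  have := hβ.1.ne'
  field_simp

lemma log_two_sub_biasEntropy_mul_le_of_slope_eq {α β lam mu : ℝ} (hα : α ∈ Ioo (0 : ℝ) 1)
    (hβ : β ∈ Ioo (0 : ℝ) 1) (h1 : lam * artanh α = β * artanh (α * β))
    (h2 : mu * artanh β = α * artanh (α * β)) :
    log 2 - biasEntropy (α * β) ≤
      lam * (log 2 - biasEntropy α) + mu * (log 2 - biasEntropy β) := by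
  have hm : α * β ∈ Ioo (0 : ℝ) 1 :=
    ⟨mul_pos hα.1 hβ.1, by nlinarith [hα.1, hα.2, hβ.1, hβ.2]⟩
  have ha := artanh_pos hα
  have hb := artanh_pos hβ
  have h0 := mul_pos hm.1 (artanh_pos hm)
  have h := mul_le_mul_of_nonneg_left (le_log_two_sub_biasEntropy_div_add hα hβ) h0.le
  rw [mul_div_cancel₀ _ h0.ne'] at h
  refine h.trans (le_of_eq ?_)
  rw [eq_div_of_mul_eq ha.ne' h1, eq_div_of_mul_eq hb.ne' h2]
  have := hα.1.ne'
  have := hβ.1.ne'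
  field_simp

/-- The gap `biasEntropy (α * β) - lam * biasEntropy α - mu * biasEntropy β`, whose critical
points and boundary values decide the linear bounds below. -/
noncomputable def linearGap (lam mu : ℝ) (p : ℝ × ℝ) : ℝ :=
  biasEntropy (p.1 * p.2) - lam * biasEntropy p.1 - mu * biasEntropy p.2

lemma continuous_linearGap (lam mu : ℝ) : Continuous (linearGap lam mu) := by
  have := continuous_biasEntropy
  unfold linearGap
  fun_prop

lemma slope_eq_of_isLocalExtr {α β lam mu : ℝ} (hα : α ∈ Ioo (0 : ℝ) 1)
    (hβ : β ∈ Ioo (0 : ℝ) 1) (h : IsLocalExtr (linearGap lam mu) (α, β)) :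
    lam * artanh α = β * artanh (α * β) ∧ mu * artanh β = α * artanh (α * β) := by
  constructor
  · have h1 : IsLocalExtr (fun a => linearGap lam mu (a, β)) α :=
      h.comp_continuous (g := fun a : ℝ => (a, β)) (b := α) (by fun_prop)
    have := h1.hasDerivAt_eq_zero
      ((hasDerivAt_biasEntropy_mul_sub lam hα hβ).sub_const (mu * biasEntropy β))
    linarith
  · have h1 : IsLocalExtr (fun b => linearGap lam mu (α, b)) β :=
      h.comp_continuous (g := fun b : ℝ => (α, b)) (b := β) (by fun_prop)
    have e : (fun b => linearGap lam mu (α, b)) =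
        fun b => biasEntropy (b * α) - mu * biasEntropy b - lam * biasEntropy α := by
      funext b
      simp only [linearGap, mul_comm α b]
      ring
    rw [e] at h1
    have := h1.hasDerivAt_eq_zero
      ((hasDerivAt_biasEntropy_mul_sub mu hβ hα).sub_const (lam * biasEntropy α))
    rw [mul_comm β α] at this
    linarith

/-- Below the point with biases `α₀, β₀`, the entropy of the sum dominates a linear function of
the two entropies that touches it at this point and has slopes between the partial derivatives
and `1`. -/
lemma add_le_biasEntropy_mul {α₀ β₀ lam mu : ℝ} (hα₀ : α₀ ∈ Ioo (0 : ℝ) 1)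
    (hβ₀ : β₀ ∈ Ioo (0 : ℝ) 1)
    (hl : lam ∈ Icc (β₀ * artanh (α₀ * β₀) / artanh α₀) 1)
    (hm : mu ∈ Icc (α₀ * artanh (β₀ * α₀) / artanh β₀) 1)
    (heq : lam * biasEntropy α₀ + mu * biasEntropy β₀ = biasEntropy (α₀ * β₀))
    {α β : ℝ} (hα : α ∈ Icc α₀ 1) (hβ : β ∈ Icc β₀ 1) :
    lam * biasEntropy α + mu * biasEntropy β ≤ biasEntropy (α * β) := by
  obtain ⟨⟨a, b⟩, hab, hmin⟩ := (isCompact_Icc.prod isCompact_Icc).exists_isMinOn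
    (s := Icc α₀ 1 ×ˢ Icc β₀ 1) ⟨(α, β), hα, hβ⟩ (continuous_linearGap lam mu).continuousOn
  suffices h : 0 ≤ linearGap lam mu (a, b) by
    have : linearGap lam mu (a, b) ≤ linearGap lam mu (α, β) := hmin ⟨hα, hβ⟩
    simp only [linearGap] at this h
    linarith
  obtain ⟨ha, hb⟩ := hab
  simp only at ha hb
  have hb0 := biasEntropy_nonneg (by linarith [hb.1, hβ₀.1]) hb.2
  have ha0 := biasEntropy_nonneg (by linarith [ha.1, hα₀.1]) ha.2
  rcases ha.2.eq_or_lt with rfl | ha1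
  · simp only [linearGap, biasEntropy_one, one_mul]
    nlinarith [hm.2]
  rcases hb.2.eq_or_lt with rfl | hb1
  · simp only [linearGap, biasEntropy_one, mul_one]
    nlinarith [hl.2]
  rcases ha.1.eq_or_lt with rfl | ha2
  · have := biasEntropy_mul_sub_monotoneOn hβ₀ hα₀ hm.1 ⟨le_rfl, hβ₀.2.le⟩ hb hb.1
    simp only [linearGap, mul_comm _ α₀] at this ⊢
    linarith
  rcases hb.1.eq_or_lt with rfl | hb2
  · have := biasEntropy_mul_sub_monotoneOn hα₀ hβ₀ hl.1 ⟨le_rfl, hα₀.2.le⟩ ha ha.1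
    simp only [linearGap] at this ⊢
    linarith
  have hloc : IsLocalMin (linearGap lam mu) (a, b) :=
    hmin.isLocalMin (prod_mem_nhds (Icc_mem_nhds ha2 ha1) (Icc_mem_nhds hb2 hb1))
  have ha' : a ∈ Ioo (0 : ℝ) 1 := ⟨hα₀.1.trans ha2, ha1⟩
  have hb' : b ∈ Ioo (0 : ℝ) 1 := ⟨hβ₀.1.trans hb2, hb1⟩
  obtain ⟨h1, h2⟩ := slope_eq_of_isLocalExtr ha' hb' (Or.inl hloc)
  have := add_le_biasEntropy_mul_of_slope_eq ha' hb' h1 h2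
  simp only [linearGap]
  linarith

/-- Above the point with biases `α₀, β₀`, the entropy deficit of the sum is dominated by a linear
function of the two deficits that touches it at this point and has slopes between `0` and the
partial derivatives. -/
lemma log_two_sub_biasEntropy_mul_le {α₀ β₀ lam mu : ℝ} (hα₀ : α₀ ∈ Ioo (0 : ℝ) 1)
    (hβ₀ : β₀ ∈ Ioo (0 : ℝ) 1)
    (hl : lam ∈ Icc 0 (β₀ * artanh (α₀ * β₀) / artanh α₀))
    (hm : mu ∈ Icc 0 (α₀ * artanh (β₀ * α₀) / artanh β₀))
    (heq : lam * (log 2 - biasEntropy α₀) + mu * (log 2 - biasEntropy β₀) =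
      log 2 - biasEntropy (α₀ * β₀))
    {α β : ℝ} (hα : α ∈ Icc 0 α₀) (hβ : β ∈ Icc 0 β₀) :
    log 2 - biasEntropy (α * β) ≤
      lam * (log 2 - biasEntropy α) + mu * (log 2 - biasEntropy β) := by
  obtain ⟨⟨a, b⟩, hab, hmin⟩ := (isCompact_Icc.prod isCompact_Icc).exists_isMinOn
    (s := Icc 0 α₀ ×ˢ Icc 0 β₀) ⟨(α, β), hα, hβ⟩ (continuous_linearGap lam mu).continuousOn
  suffices h : log 2 - lam * log 2 - mu * log 2 ≤ linearGap lam mu (a, b) by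
    have : linearGap lam mu (a, b) ≤ linearGap lam mu (α, β) := hmin ⟨hα, hβ⟩
    simp only [linearGap] at this h
    linarith
  obtain ⟨ha, hb⟩ := hab
  simp only at ha hb
  have hb0 := biasEntropy_le_log_two b
  have ha0 := biasEntropy_le_log_two a
  rcases ha.1.eq_or_lt with rfl | ha1
  · simp only [linearGap, biasEntropy_zero, zero_mul]
    nlinarith [hm.1]
  rcases hb.1.eq_or_lt with rfl | hb1
  · simp only [linearGap, biasEntropy_zero, mul_zero]
    nlinarith [hl.1]
  rcases ha.2.eq_or_lt with rfl | ha2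
  · have := biasEntropy_mul_sub_antitoneOn hβ₀ hα₀ hm.2 hb ⟨hβ₀.1.le, le_rfl⟩ hb.2
    simp only [linearGap, mul_comm _ a] at this ⊢
    linarith
  rcases hb.2.eq_or_lt with rfl | hb2
  · have := biasEntropy_mul_sub_antitoneOn hα₀ hβ₀ hl.2 ha ⟨hα₀.1.le, le_rfl⟩ ha.2
    simp only [linearGap] at this ⊢
    linarith
  have hloc : IsLocalMin (linearGap lam mu) (a, b) :=
    hmin.isLocalMin (prod_mem_nhds (Icc_mem_nhds ha1 ha2) (Icc_mem_nhds hb1 hb2))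
  have ha' : a ∈ Ioo (0 : ℝ) 1 := ⟨ha1, ha2.trans hα₀.2⟩
  have hb' : b ∈ Ioo (0 : ℝ) 1 := ⟨hb1, hb2.trans hβ₀.2⟩
  obtain ⟨h1, h2⟩ := slope_eq_of_isLocalExtr ha' hb' (Or.inl hloc)
  have := log_two_sub_biasEntropy_mul_le_of_slope_eq ha' hb' h1 h2
  simp only [linearGap]
  linarith

/-- Subadditivity of the binary sum entropy as a function of the pair of entropies. -/
lemma biasEntropy_mul_subadditive {α β α₁ β₁ α₂ β₂ : ℝ} (hα : α ∈ Icc (0 : ℝ) 1)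
    (hβ : β ∈ Icc (0 : ℝ) 1) (hα₁ : α₁ ∈ Icc (0 : ℝ) 1) (hβ₁ : β₁ ∈ Icc (0 : ℝ) 1)
    (hα₂ : α₂ ∈ Icc (0 : ℝ) 1) (hβ₂ : β₂ ∈ Icc (0 : ℝ) 1)
    (hx : biasEntropy α = biasEntropy α₁ + biasEntropy α₂)
    (hy : biasEntropy β = biasEntropy β₁ + biasEntropy β₂) :
    biasEntropy (α * β) ≤ biasEntropy (α₁ * β₁) + biasEntropy (α₂ * β₂) := by
  have le1 := biasEntropy_le_mul_right hα₁ hβ₁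
  have le2 := biasEntropy_le_mul_right hα₂ hβ₂
  have le3 := biasEntropy_le_mul_left hα₁ hβ₁
  have le4 := biasEntropy_le_mul_left hα₂ hβ₂
  rcases hα.1.eq_or_lt with rfl | hα0
  · rw [zero_mul]
    linarith
  rcases hβ.1.eq_or_lt with rfl | hβ0
  · rw [mul_zero]
    linarith
  rcases hα.2.eq_or_lt with rfl | hα1
  · rw [one_mul]
    linarith
  rcases hβ.2.eq_or_lt with rfl | hβ1
  · rw [mul_one]
    linarith
  have Hα : α ∈ Ioo (0 : ℝ) 1 := ⟨hα0, hα1⟩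
  have Hβ : β ∈ Ioo (0 : ℝ) 1 := ⟨hβ0, hβ1⟩
  set s := β * artanh (α * β) / artanh α with hs
  set r := α * artanh (β * α) / artanh β with hr
  have hs1 : s ≤ 1 := (slope_mem_Icc Hα Hβ).2
  have hr1 : r ≤ 1 := (slope_mem_Icc Hβ Hα).2
  have hcrit : s * biasEntropy α + r * biasEntropy β ≤ biasEntropy (α * β) := by
    refine add_le_biasEntropy_mul_of_slope_eq Hα Hβ ?_ ?_
    · rw [hs, div_mul_cancel₀ _ (artanh_pos Hα).ne']
    · rw [hr, div_mul_cancel₀ _ (artanh_pos Hβ).ne', mul_comm β α]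
  -- Slopes on the segment from `(s, r)` to `(1, 1)` take every intermediate value at `(α, β)`.
  obtain ⟨θ, hθ, hθe⟩ : ∃ θ ∈ Icc (0 : ℝ) 1,
      (s + θ * (1 - s)) * biasEntropy α + (r + θ * (1 - r)) * biasEntropy β =
        biasEntropy (α * β) := by
    have hcont : ContinuousOn (fun θ : ℝ =>
        (s + θ * (1 - s)) * biasEntropy α + (r + θ * (1 - r)) * biasEntropy β) (Icc 0 1) := by
      fun_prop
    have := intermediate_value_Icc (zero_le_one' ℝ) hcont
    exact this ⟨by linarith, by linarith [biasEntropy_mul_le_add Hα Hβ]⟩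
  have hl : s + θ * (1 - s) ∈ Icc s 1 := ⟨by nlinarith [hθ.1], by nlinarith [hθ.2]⟩
  have hm : r + θ * (1 - r) ∈ Icc r 1 := ⟨by nlinarith [hθ.1], by nlinarith [hθ.2]⟩
  have mono : ∀ a b : ℝ, a ∈ Icc (0 : ℝ) 1 → b ∈ Icc (0 : ℝ) 1 → biasEntropy b ≤ biasEntropy a →
      b ∈ Icc a 1 := fun a b ha hb h =>
    ⟨(biasEntropy_strictAntiOn.le_iff_ge hb ha).1 h, hb.2⟩
  have n1 := biasEntropy_nonneg (by linarith [hα₁.1]) hα₁.2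
  have n2 := biasEntropy_nonneg (by linarith [hα₂.1]) hα₂.2
  have n3 := biasEntropy_nonneg (by linarith [hβ₁.1]) hβ₁.2
  have n4 := biasEntropy_nonneg (by linarith [hβ₂.1]) hβ₂.2
  have h1 := add_le_biasEntropy_mul Hα Hβ hl hm hθe
    (mono α α₁ hα hα₁ (by linarith)) (mono β β₁ hβ hβ₁ (by linarith))
  have h2 := add_le_biasEntropy_mul Hα Hβ hl hm hθe
    (mono α α₂ hα hα₂ (by linarith)) (mono β β₂ hβ hβ₂ (by linarith))
  rw [hx, hy] at hθe
  linarith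

/-- Superadditivity of the entropy deficit of a binary sum as a function of the pair of
deficits. -/
lemma log_two_add_biasEntropy_mul_le {α β α₁ β₁ α₂ β₂ : ℝ} (hα : α ∈ Icc (0 : ℝ) 1)
    (hβ : β ∈ Icc (0 : ℝ) 1) (hα₁ : α₁ ∈ Icc (0 : ℝ) 1) (hβ₁ : β₁ ∈ Icc (0 : ℝ) 1)
    (hα₂ : α₂ ∈ Icc (0 : ℝ) 1) (hβ₂ : β₂ ∈ Icc (0 : ℝ) 1)
    (hx : log 2 + biasEntropy α = biasEntropy α₁ + biasEntropy α₂)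
    (hy : log 2 + biasEntropy β = biasEntropy β₁ + biasEntropy β₂) :
    log 2 + biasEntropy (α * β) ≤ biasEntropy (α₁ * β₁) + biasEntropy (α₂ * β₂) := by
  have le1 := biasEntropy_le_mul_right hα₁ hβ₁
  have le2 := biasEntropy_le_mul_right hα₂ hβ₂
  have le3 := biasEntropy_le_mul_left hα₁ hβ₁
  have le4 := biasEntropy_le_mul_left hα₂ hβ₂
  rcases hα.1.eq_or_lt with rfl | hα0
  · rw [zero_mul]
    linarith
  rcases hβ.1.eq_or_lt with rfl | hβ0
  · rw [mul_zero]
    linarith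
  rcases hα.2.eq_or_lt with rfl | hα1
  · rw [one_mul]
    linarith
  rcases hβ.2.eq_or_lt with rfl | hβ1
  · rw [mul_one]
    linarith
  have Hα : α ∈ Ioo (0 : ℝ) 1 := ⟨hα0, hα1⟩
  have Hβ : β ∈ Ioo (0 : ℝ) 1 := ⟨hβ0, hβ1⟩
  set s := β * artanh (α * β) / artanh α with hs
  set r := α * artanh (β * α) / artanh β with hr
  have hs0 : 0 ≤ s := (slope_mem_Icc Hα Hβ).1
  have hr0 : 0 ≤ r := (slope_mem_Icc Hβ Hα).1
  have hcrit : log 2 - biasEntropy (α * β) ≤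
      s * (log 2 - biasEntropy α) + r * (log 2 - biasEntropy β) := by
    refine log_two_sub_biasEntropy_mul_le_of_slope_eq Hα Hβ ?_ ?_
    · rw [hs, div_mul_cancel₀ _ (artanh_pos Hα).ne']
    · rw [hr, div_mul_cancel₀ _ (artanh_pos Hβ).ne', mul_comm β α]
  -- Slopes on the segment from `(0, 0)` to `(s, r)` take every intermediate value at `(α, β)`.
  obtain ⟨θ, hθ, hθe⟩ : ∃ θ ∈ Icc (0 : ℝ) 1,
      (θ * s) * (log 2 - biasEntropy α) + (θ * r) * (log 2 - biasEntropy β) =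
        log 2 - biasEntropy (α * β) := by
    have hcont : ContinuousOn (fun θ : ℝ =>
        (θ * s) * (log 2 - biasEntropy α) + (θ * r) * (log 2 - biasEntropy β)) (Icc 0 1) := by
      fun_prop
    have := intermediate_value_Icc (zero_le_one' ℝ) hcont
    exact this ⟨by linarith [biasEntropy_le_log_two (α * β)], by linarith⟩
  have hl : θ * s ∈ Icc 0 s := ⟨mul_nonneg hθ.1 hs0, by nlinarith [hθ.2]⟩
  have hm : θ * r ∈ Icc 0 r := ⟨mul_nonneg hθ.1 hr0, by nlinarith [hθ.2]⟩
  have mono : ∀ a b : ℝ, a ∈ Icc (0 : ℝ) 1 → b ∈ Icc (0 : ℝ) 1 → biasEntropy a ≤ biasEntropy b →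
      b ∈ Icc 0 a := fun a b ha hb h =>
    ⟨hb.1, (biasEntropy_strictAntiOn.le_iff_ge ha hb).1 h⟩
  have n1 := biasEntropy_le_log_two α₁
  have n2 := biasEntropy_le_log_two α₂
  have n3 := biasEntropy_le_log_two β₁
  have n4 := biasEntropy_le_log_two β₂
  have h1 := log_two_sub_biasEntropy_mul_le Hα Hβ hl hm hθe
    (mono α α₁ hα hα₁ (by linarith)) (mono β β₁ hβ hβ₁ (by linarith))
  have h2 := log_two_sub_biasEntropy_mul_le Hα Hβ hl hm hθe
    (mono α α₂ hα hα₂ (by linarith)) (mono β β₂ hβ hβ₂ (by linarith))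
  have e1 : biasEntropy α = biasEntropy α₁ + biasEntropy α₂ - log 2 := by linarith
  have e2 : biasEntropy β = biasEntropy β₁ + biasEntropy β₂ - log 2 := by linarith
  rw [e1, e2] at hθe
  linarith

/-! ### The minimal sum entropy as an explicit function -/

/-- The entropy of the sum of two independent bits with entropies `x` and `y` in `[0, log 2]`. -/
noncomputable def binarySum (x y : ℝ) : ℝ :=
  biasEntropy (Function.invFunOn biasEntropy (Icc 0 1) x *
    Function.invFunOn biasEntropy (Icc 0 1) y)

lemma binarySum_comm (x y : ℝ) : binarySum x y = binarySum y x := by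
  rw [binarySum, mul_comm, binarySum]

lemma binarySum_biasEntropy {α β : ℝ} (hα : |α| ≤ 1) (hβ : |β| ≤ 1) :
    binarySum (biasEntropy α) (biasEntropy β) = biasEntropy (α * β) := by
  have h := biasEntropy_strictAntiOn.injOn.leftInvOn_invFunOn
  rw [binarySum, ← biasEntropy_abs α, ← biasEntropy_abs β, h ⟨abs_nonneg α, hα⟩,
    h ⟨abs_nonneg β, hβ⟩, ← abs_mul, biasEntropy_abs]

lemma abs_le_one_of_mem_Icc {α : ℝ} (hα : α ∈ Icc (0 : ℝ) 1) : |α| ≤ 1 :=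
  (abs_of_nonneg hα.1).trans_le hα.2

/-- The sum of two independent bits with `P(X = 1) = m` and `P(Y = 1) = l`. -/
lemma binarySum_binEntropy {m l : ℝ} (hm : m ∈ Icc (0 : ℝ) 1) (hl : l ∈ Icc (0 : ℝ) 1) :
    binarySum (binEntropy m) (binEntropy l) = binEntropy (m * (1 - l) + l * (1 - m)) := by
  have e : ∀ p : ℝ, binEntropy p = biasEntropy (1 - 2 * p) := by
    intro p
    rw [biasEntropy]
    congr 1
    ring
  rw [e m, e l, e, binarySum_biasEntropy]
  · congr 1
    ring
  · exact abs_le.2 ⟨by linarith [hm.2], by linarith [hm.1]⟩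
  · exact abs_le.2 ⟨by linarith [hl.2], by linarith [hl.1]⟩

lemma binarySum_zero_left {y : ℝ} (hy : y ∈ Icc 0 (log 2)) : binarySum 0 y = y := by
  obtain ⟨β, hβ, rfl⟩ := exists_biasEntropy_eq hy.1 hy.2
  rw [← biasEntropy_one, binarySum_biasEntropy (by simp) (abs_le_one_of_mem_Icc hβ), one_mul]

lemma binarySum_log_two_left {y : ℝ} (hy : y ∈ Icc 0 (log 2)) :
    binarySum (log 2) y = log 2 := by
  obtain ⟨β, hβ, rfl⟩ := exists_biasEntropy_eq hy.1 hy.2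
  rw [← biasEntropy_zero, binarySum_biasEntropy (by simp) (abs_le_one_of_mem_Icc hβ), zero_mul]

lemma le_binarySum_left {x y : ℝ} (hx : x ∈ Icc 0 (log 2)) (hy : y ∈ Icc 0 (log 2)) :
    x ≤ binarySum x y := by
  obtain ⟨α, hα, rfl⟩ := exists_biasEntropy_eq hx.1 hx.2
  obtain ⟨β, hβ, rfl⟩ := exists_biasEntropy_eq hy.1 hy.2
  rw [binarySum_biasEntropy (abs_le_one_of_mem_Icc hα) (abs_le_one_of_mem_Icc hβ)]
  exact biasEntropy_le_mul_right hα hβ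

lemma le_binarySum_right {x y : ℝ} (hx : x ∈ Icc 0 (log 2)) (hy : y ∈ Icc 0 (log 2)) :
    y ≤ binarySum x y := binarySum_comm y x ▸ le_binarySum_left hy hx

lemma binarySum_supporting_line {x₀ y : ℝ} (hx : x₀ ∈ Icc 0 (log 2)) (hy : y ∈ Icc 0 (log 2)) :
    ∃ s ∈ Icc (0 : ℝ) 1, ∀ x ∈ Icc 0 (log 2),
      binarySum x₀ y + s * (x - x₀) ≤ binarySum x y := by
  obtain ⟨α₀, hα₀, rfl⟩ := exists_biasEntropy_eq hx.1 hx.2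
  obtain ⟨β, hβ, rfl⟩ := exists_biasEntropy_eq hy.1 hy.2
  have aα := abs_le_one_of_mem_Icc hα₀
  have aβ := abs_le_one_of_mem_Icc hβ
  rw [binarySum_biasEntropy aα aβ]
  rcases hα₀.1.eq_or_lt with rfl | h0
  · refine ⟨1, by simp, fun x hx => ?_⟩
    rw [zero_mul]
    linarith [le_binarySum_left hx hy]
  rcases hα₀.2.eq_or_lt with rfl | h1
  · refine ⟨0, by simp, fun x hx => ?_⟩
    rw [one_mul]
    linarith [le_binarySum_right hx hy]
  rcases hβ.1.eq_or_lt with rfl | h2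
  · refine ⟨0, by simp, fun x hx => ?_⟩
    rw [mul_zero]
    linarith [le_binarySum_right hx hy]
  rcases hβ.2.eq_or_lt with rfl | h3
  · refine ⟨1, by simp, fun x hx => ?_⟩
    rw [mul_one]
    linarith [le_binarySum_left hx hy]
  refine ⟨β * artanh (α₀ * β) / artanh α₀, slope_mem_Icc ⟨h0, h1⟩ ⟨h2, h3⟩, fun x hx => ?_⟩
  obtain ⟨α, hα, rfl⟩ := exists_biasEntropy_eq hx.1 hx.2
  rw [binarySum_biasEntropy (abs_le_one_of_mem_Icc hα) aβ]
  exact biasEntropy_mul_supporting_line ⟨h0, h1⟩ ⟨h2, h3⟩ hα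

lemma binarySum_add_le {a b u v : ℝ} (ha : 0 ≤ a) (hb : 0 ≤ b) (hu : 0 ≤ u) (hv : 0 ≤ v)
    (hau : a + u ≤ log 2) (hbv : b + v ≤ log 2) :
    binarySum (a + u) (b + v) ≤ binarySum a b + binarySum u v := by
  obtain ⟨α, hα, e⟩ := exists_biasEntropy_eq (add_nonneg ha hu) hau
  obtain ⟨β, hβ, e'⟩ := exists_biasEntropy_eq (add_nonneg hb hv) hbv
  obtain ⟨α₁, hα₁, rfl⟩ := exists_biasEntropy_eq ha (by linarith)
  obtain ⟨α₂, hα₂, rfl⟩ := exists_biasEntropy_eq hu (by linarith)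
  obtain ⟨β₁, hβ₁, rfl⟩ := exists_biasEntropy_eq hb (by linarith)
  obtain ⟨β₂, hβ₂, rfl⟩ := exists_biasEntropy_eq hv (by linarith)
  rw [← e, ← e', binarySum_biasEntropy (abs_le_one_of_mem_Icc hα) (abs_le_one_of_mem_Icc hβ),
    binarySum_biasEntropy (abs_le_one_of_mem_Icc hα₁) (abs_le_one_of_mem_Icc hβ₁),
    binarySum_biasEntropy (abs_le_one_of_mem_Icc hα₂) (abs_le_one_of_mem_Icc hβ₂)]
  exact biasEntropy_mul_subadditive hα hβ hα₁ hβ₁ hα₂ hβ₂ e e'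

lemma log_two_add_binarySum_le {a b u v : ℝ} (ha : a ∈ Icc 0 (log 2)) (hb : b ∈ Icc 0 (log 2))
    (hu : u ∈ Icc 0 (log 2)) (hv : v ∈ Icc 0 (log 2))
    (hau : log 2 ≤ a + u) (hbv : log 2 ≤ b + v) :
    log 2 + binarySum (a + u - log 2) (b + v - log 2) ≤ binarySum a b + binarySum u v := by
  obtain ⟨α, hα, e⟩ := exists_biasEntropy_eq (sub_nonneg.2 hau) (by linarith [ha.2, hu.2])
  obtain ⟨β, hβ, e'⟩ := exists_biasEntropy_eq (sub_nonneg.2 hbv) (by linarith [hb.2, hv.2])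
  obtain ⟨α₁, hα₁, rfl⟩ := exists_biasEntropy_eq ha.1 ha.2
  obtain ⟨α₂, hα₂, rfl⟩ := exists_biasEntropy_eq hu.1 hu.2
  obtain ⟨β₁, hβ₁, rfl⟩ := exists_biasEntropy_eq hb.1 hb.2
  obtain ⟨β₂, hβ₂, rfl⟩ := exists_biasEntropy_eq hv.1 hv.2
  rw [← e, ← e', binarySum_biasEntropy (abs_le_one_of_mem_Icc hα) (abs_le_one_of_mem_Icc hβ),
    binarySum_biasEntropy (abs_le_one_of_mem_Icc hα₁) (abs_le_one_of_mem_Icc hβ₁),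
    binarySum_biasEntropy (abs_le_one_of_mem_Icc hα₂) (abs_le_one_of_mem_Icc hβ₂)]
  exact log_two_add_biasEntropy_mul_le hα hβ hα₁ hβ₁ hα₂ hβ₂ (by linarith) (by linarith)

/-- The minimal entropy of a sum in a group of order `2 ^ n`, as a function of the two entropies
`x` and `y`: a shifted copy of `binarySum` when both lie in the same interval
`[k log 2, (k + 1) log 2]`, and their maximum otherwise. It does not depend on `n`, and the formula
is extended to all real arguments. -/
noncomputable def dyadicSum (x y : ℝ) : ℝ :=
  if ⌊x / log 2⌋ = ⌊y / log 2⌋ then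
    ⌊x / log 2⌋ * log 2 + binarySum (x - ⌊x / log 2⌋ * log 2) (y - ⌊x / log 2⌋ * log 2)
  else max x y

lemma dyadicSum_comm (x y : ℝ) : dyadicSum x y = dyadicSum y x := by
  unfold dyadicSum
  by_cases h : ⌊x / log 2⌋ = ⌊y / log 2⌋
  · rw [if_pos h, if_pos h.symm, binarySum_comm, h]
  · rw [if_neg h, if_neg (Ne.symm h), max_comm]

lemma log_two_pos : 0 < log 2 := log_pos one_lt_two

lemma floor_div_log_two_eq {k : ℤ} {x : ℝ} (h0 : k * log 2 ≤ x) (h1 : x < (k + 1) * log 2) :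
    ⌊x / log 2⌋ = k := by
  rw [Int.floor_eq_iff]
  exact ⟨(le_div_iff₀ log_two_pos).2 h0, (div_lt_iff₀ log_two_pos).2 h1⟩

lemma exists_mem_block (x : ℝ) : ∃ k : ℤ, k * log 2 ≤ x ∧ x ≤ (k + 1) * log 2 :=
  ⟨⌊x / log 2⌋, (le_div_iff₀ log_two_pos).1 (Int.floor_le _),
    ((div_lt_iff₀ log_two_pos).1 (Int.lt_floor_add_one _)).le⟩

lemma dyadicSum_of_le_of_le {k : ℤ} {x y : ℝ} (hx : x ≤ k * log 2) (hy : k * log 2 ≤ y) :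
    dyadicSum x y = y := by
  have hL := log_two_pos
  unfold dyadicSum
  split_ifs with h
  · have h1 : k ≤ ⌊y / log 2⌋ := Int.le_floor.2 ((le_div_iff₀ hL).2 hy)
    have h2 : (⌊x / log 2⌋ : ℝ) * log 2 ≤ x := (le_div_iff₀ hL).1 (Int.floor_le _)
    have h3 : y < (⌊y / log 2⌋ + 1) * log 2 := (div_lt_iff₀ hL).1 (Int.lt_floor_add_one _)
    rw [h] at h2 ⊢
    have h4 : (k : ℝ) * log 2 ≤ ⌊y / log 2⌋ * log 2 :=
      mul_le_mul_of_nonneg_right (by exact_mod_cast h1) hL.le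
    have h5 : x - ⌊y / log 2⌋ * log 2 = 0 := by linarith
    rw [h5, binarySum_zero_left ⟨by linarith, by linarith⟩]
    ring
  · exact max_eq_right (hx.trans hy)

lemma dyadicSum_of_mem_block {k : ℤ} {x y : ℝ} (hx0 : k * log 2 ≤ x) (hx1 : x ≤ (k + 1) * log 2)
    (hy0 : k * log 2 ≤ y) (hy1 : y ≤ (k + 1) * log 2) :
    dyadicSum x y = k * log 2 + binarySum (x - k * log 2) (y - k * log 2) := by
  have hL := log_two_pos
  have key : ∀ x y : ℝ, k * log 2 ≤ x → x ≤ (k + 1) * log 2 → y = (k + 1) * log 2 →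
      dyadicSum x y = k * log 2 + binarySum (y - k * log 2) (x - k * log 2) := by
    intro x y hx0 hx1 hy
    have e : y - k * log 2 = log 2 := by rw [hy]; ring
    rw [dyadicSum_of_le_of_le (k := k + 1) (by push_cast; exact hx1) (by push_cast; exact hy.ge),
      e, binarySum_log_two_left ⟨by linarith, by linarith⟩]
    linarith
  rcases hy1.eq_or_lt with hy1 | hy1
  · rw [key x y hx0 hx1 hy1, binarySum_comm]
  rcases hx1.eq_or_lt with hx1 | hx1
  · rw [dyadicSum_comm, key y x hy0 hy1.le hx1]
  · rw [dyadicSum, floor_div_log_two_eq hx0 hx1, floor_div_log_two_eq hy0 hy1, if_pos rfl]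

lemma le_dyadicSum_right (x y : ℝ) : y ≤ dyadicSum x y := by
  obtain ⟨k, h0, h1⟩ := exists_mem_block y
  rcases le_total x (k * log 2) with h | h
  · exact (dyadicSum_of_le_of_le h h0).ge
  rcases le_total x ((k + 1) * log 2) with h' | h'
  · rw [dyadicSum_of_mem_block h h' h0 h1]
    linarith [le_binarySum_right (x := x - k * log 2) (y := y - k * log 2)
      ⟨by linarith, by linarith⟩ ⟨by linarith, by linarith⟩]
  · rw [dyadicSum_comm, dyadicSum_of_le_of_le (k := k + 1) (by push_cast; exact h1)
      (by push_cast; exact h')]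
    exact h1.trans h'

lemma le_dyadicSum_left (x y : ℝ) : x ≤ dyadicSum x y := dyadicSum_comm y x ▸ le_dyadicSum_right y x

lemma dyadicSum_supporting_line (x₀ y : ℝ) :
    ∃ s ∈ Icc (0 : ℝ) 1, ∀ x, dyadicSum x₀ y + s * (x - x₀) ≤ dyadicSum x y := by
  obtain ⟨k, h0, h1⟩ := exists_mem_block y
  rcases le_total x₀ (k * log 2) with h | h
  · refine ⟨0, by simp, fun x => ?_⟩
    rw [dyadicSum_of_le_of_le h h0]
    linarith [le_dyadicSum_right x y]
  rcases le_total x₀ ((k + 1) * log 2) with h' | h'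
  · have hL := log_two_pos
    have hy : y - k * log 2 ∈ Icc 0 (log 2) := ⟨by linarith, by linarith⟩
    obtain ⟨s, hs, hline⟩ := binarySum_supporting_line (x₀ := x₀ - k * log 2)
      ⟨by linarith, by linarith⟩ hy
    refine ⟨s, hs, fun x => ?_⟩
    rw [dyadicSum_of_mem_block h h' h0 h1]
    rcases le_total x (k * log 2) with g | g
    · have := hline 0 ⟨le_rfl, hL.le⟩
      rw [binarySum_zero_left hy] at this
      rw [dyadicSum_of_le_of_le g h0]
      nlinarith [hs.1]
    rcases le_total x ((k + 1) * log 2) with g' | g'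
    · have := hline (x - k * log 2) ⟨by linarith, by linarith⟩
      rw [dyadicSum_of_mem_block g g' h0 h1]
      linarith
    · have := hline (log 2) ⟨hL.le, le_rfl⟩
      rw [binarySum_log_two_left hy] at this
      rw [dyadicSum_comm x, dyadicSum_of_le_of_le (k := k + 1) (by push_cast; exact h1)
        (by push_cast; exact g')]
      nlinarith [hs.2]
  · refine ⟨1, by simp, fun x => ?_⟩
    rw [dyadicSum_comm x₀, dyadicSum_of_le_of_le (k := k + 1) (by push_cast; exact h1)
      (by push_cast; exact h')]
    linarith [le_dyadicSum_left x y]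

lemma dyadicSum_mono_left {x x' : ℝ} (y : ℝ) (h : x ≤ x') : dyadicSum x y ≤ dyadicSum x' y := by
  obtain ⟨s, hs, hline⟩ := dyadicSum_supporting_line x y
  nlinarith [hline x', hs.1]

lemma dyadicSum_mono_right (x : ℝ) {y y' : ℝ} (h : y ≤ y') : dyadicSum x y ≤ dyadicSum x y' := by
  rw [dyadicSum_comm x, dyadicSum_comm x]
  exact dyadicSum_mono_left x h

lemma dyadicSum_convex_left {m : ℝ} (hm : m ∈ Icc (0 : ℝ) 1) (x x' y : ℝ) :
    dyadicSum ((1 - m) * x + m * x') y ≤ (1 - m) * dyadicSum x y + m * dyadicSum x' y := by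
  obtain ⟨s, -, hline⟩ := dyadicSum_supporting_line ((1 - m) * x + m * x') y
  have h1 := mul_le_mul_of_nonneg_left (hline x) (sub_nonneg.2 hm.2)
  have h2 := mul_le_mul_of_nonneg_left (hline x') hm.1
  linarith

lemma dyadicSum_convex_right {l : ℝ} (hl : l ∈ Icc (0 : ℝ) 1) (x y y' : ℝ) :
    dyadicSum x ((1 - l) * y + l * y') ≤ (1 - l) * dyadicSum x y + l * dyadicSum x y' := by
  simp only [dyadicSum_comm x]
  exact dyadicSum_convex_left hl y y' x

/-- The two-variable form of Jensen's inequality for `dyadicSum` and two-point distributions. -/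
lemma dyadicSum_jensen {m l : ℝ} (hm : m ∈ Icc (0 : ℝ) 1) (hl : l ∈ Icc (0 : ℝ) 1)
    (x x' y y' : ℝ) :
    dyadicSum ((1 - m) * x + m * x') ((1 - l) * y + l * y') ≤
      (1 - m) * (1 - l) * dyadicSum x y + (1 - m) * l * dyadicSum x y' +
        m * (1 - l) * dyadicSum x' y + m * l * dyadicSum x' y' := by
  have h := dyadicSum_convex_left hm x x' ((1 - l) * y + l * y')
  have h1 := mul_le_mul_of_nonneg_left (dyadicSum_convex_right hl x y y') (sub_nonneg.2 hm.2)
  have h2 := mul_le_mul_of_nonneg_left (dyadicSum_convex_right hl x' y y') hm.1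
  linarith

/-- One bit can be split off the two summands. -/
lemma dyadicSum_add_le {a b : ℝ} (ha : a ∈ Icc 0 (log 2)) (hb : b ∈ Icc 0 (log 2)) (u v : ℝ) :
    dyadicSum (a + u) (b + v) ≤ binarySum a b + dyadicSum u v := by
  have hL := log_two_pos
  have same : ∀ (k : ℤ) (u v : ℝ), k * log 2 ≤ u → u ≤ (k + 1) * log 2 → k * log 2 ≤ v →
      v ≤ (k + 1) * log 2 → dyadicSum (a + u) (b + v) ≤ binarySum a b + dyadicSum u v := by
    intro k u v hu0 hu1 hv0 hv1
    rw [dyadicSum_of_mem_block hu0 hu1 hv0 hv1]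
    have ha0 := ha.1
    have hb0 := hb.1
    have ha1 := ha.2
    have hb1 := hb.2
    have hu : u - k * log 2 ∈ Icc 0 (log 2) := ⟨by linarith, by linarith⟩
    have hv : v - k * log 2 ∈ Icc 0 (log 2) := ⟨by linarith, by linarith⟩
    rcases le_total (a + u) ((k + 1) * log 2) with h | h <;>
      rcases le_total (b + v) ((k + 1) * log 2) with h' | h'
    · rw [dyadicSum_of_mem_block (k := k) (by linarith) h (by linarith) h']
      have := binarySum_add_le ha0 hb0 hu.1 hv.1 (by linarith) (by linarith)
      rw [add_sub_assoc, add_sub_assoc]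
      linarith
    · rw [dyadicSum_of_le_of_le (k := k + 1) (by push_cast; exact h) (by push_cast; exact h')]
      linarith [le_binarySum_right ha hb, le_binarySum_right hu hv]
    · rw [dyadicSum_comm, dyadicSum_of_le_of_le (k := k + 1) (by push_cast; exact h')
        (by push_cast; exact h)]
      linarith [le_binarySum_left ha hb, le_binarySum_left hu hv]
    · rw [dyadicSum_of_mem_block (k := k + 1) (by push_cast; linarith) (by push_cast; linarith)
        (by push_cast; linarith) (by push_cast; linarith)]
      have := log_two_add_binarySum_le ha hb hu hv (by linarith) (by linarith)
      have e1 : a + u - ((k + 1 : ℤ) : ℝ) * log 2 = a + (u - k * log 2) - log 2 := by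
        push_cast; ring
      have e2 : b + v - ((k + 1 : ℤ) : ℝ) * log 2 = b + (v - k * log 2) - log 2 := by
        push_cast; ring
      rw [e1, e2]
      push_cast
      linarith
  obtain ⟨k, hv0, hv1⟩ := exists_mem_block v
  obtain ⟨j, hu0, hu1⟩ := exists_mem_block u
  -- If the blocks differ, the smaller argument can be raised to the edge of the larger one's block.
  rcases le_total u (k * log 2) with h | h
  · calc dyadicSum (a + u) (b + v) ≤ dyadicSum (a + k * log 2) (b + v) :=
          dyadicSum_mono_left _ (by linarith)
      _ ≤ binarySum a b + dyadicSum (k * log 2) v := same k _ v le_rfl (by linarith) hv0 hv1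
      _ = binarySum a b + dyadicSum u v := by
          rw [dyadicSum_of_le_of_le le_rfl hv0, dyadicSum_of_le_of_le h hv0]
  rcases le_or_gt u ((k + 1) * log 2) with h' | h'
  · exact same k u v h h' hv0 hv1
  · have hkj : k < j := by
      have : (k + 1 : ℝ) < j + 1 := lt_of_mul_lt_mul_right (h'.trans_le hu1) hL.le
      exact_mod_cast (by linarith : (k : ℝ) < j)
    have hvj : v ≤ j * log 2 := by
      have : ((k + 1 : ℤ) : ℝ) ≤ j := by exact_mod_cast hkj
      push_cast at this
      nlinarith
    calc dyadicSum (a + u) (b + v) ≤ dyadicSum (a + u) (b + j * log 2) :=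
          dyadicSum_mono_right _ (by linarith)
      _ ≤ binarySum a b + dyadicSum u (j * log 2) := same j u _ hu0 hu1 le_rfl (by linarith)
      _ = binarySum a b + dyadicSum u v := by
          rw [dyadicSum_comm u, dyadicSum_comm u, dyadicSum_of_le_of_le le_rfl hu0,
            dyadicSum_of_le_of_le hvj hu0]

/-! ### Entropy of vectors and convolution -/

section Vectors

variable {G : Type u} [Fintype G]

/-- The entropy of a vector of (not necessarily normalized) masses. -/
noncomputable def vecEntropy (p : G → ℝ) : ℝ := ∑ g, negMulLog (p g)

lemma le_one_of_mem_stdSimplex {p : G → ℝ} (hp : p ∈ stdSimplex ℝ G) (g : G) : p g ≤ 1 :=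
  hp.2 ▸ Finset.single_le_sum (fun i _ => hp.1 i) (Finset.mem_univ g)

lemma vecEntropy_nonneg {p : G → ℝ} (hp : p ∈ stdSimplex ℝ G) : 0 ≤ vecEntropy p :=
  Finset.sum_nonneg fun g _ => negMulLog_nonneg (hp.1 g) (le_one_of_mem_stdSimplex hp g)

lemma vecEntropy_eq_zero_of_support {p : G → ℝ} (hp : p ∈ stdSimplex ℝ G) (z : G)
    (h : ∀ g, p g ≠ 0 → g = z) : vecEntropy p = 0 := by
  have h0 : ∀ g, g ≠ z → p g = 0 := fun g hg => by_contra fun hne => hg (h g hne)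
  have h1 : p z = 1 := by
    rw [← hp.2]
    exact (Finset.sum_eq_single z (fun g _ hg => h0 g hg) (by simp)).symm
  refine Finset.sum_eq_zero fun g _ => ?_
  by_cases hg : g = z
  · rw [hg, h1, negMulLog_one]
  · rw [h0 g hg, negMulLog_zero]

lemma vecEntropy_smul {P : G → ℝ} (hP : P ∈ stdSimplex ℝ G) (a : ℝ) :
    vecEntropy (a • P) = negMulLog a + a * vecEntropy P := by
  simp only [vecEntropy, Pi.smul_apply, smul_eq_mul, negMulLog_mul, Finset.sum_add_distrib,
    ← Finset.sum_mul, ← Finset.mul_sum, hP.2, one_mul]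

lemma vecEntropy_add_of_disjoint {p q : G → ℝ} (h : ∀ g, p g = 0 ∨ q g = 0) :
    vecEntropy (p + q) = vecEntropy p + vecEntropy q := by
  rw [vecEntropy, vecEntropy, vecEntropy, ← Finset.sum_add_distrib]
  refine Finset.sum_congr rfl fun g _ => ?_
  rcases h g with h | h <;> simp [h]

/-- Chain rule for a mixture of distributions with disjoint supports. -/
lemma vecEntropy_mix_of_disjoint {P Q : G → ℝ} (hP : P ∈ stdSimplex ℝ G) (hQ : Q ∈ stdSimplex ℝ G)
    (h : ∀ g, P g = 0 ∨ Q g = 0) (m : ℝ) :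
    vecEntropy ((1 - m) • P + m • Q) =
      binEntropy m + ((1 - m) * vecEntropy P + m * vecEntropy Q) := by
  rw [vecEntropy_add_of_disjoint, vecEntropy_smul hP, vecEntropy_smul hQ,
    binEntropy_eq_negMulLog_add_negMulLog_one_sub]
  · ring
  · intro g
    rcases h g with h | h <;> simp [h]

/-- Concavity of the entropy, for a mixture of total mass `a + b`. -/
lemma le_vecEntropy_mix {P Q : G → ℝ} (hP : P ∈ stdSimplex ℝ G) (hQ : Q ∈ stdSimplex ℝ G)
    {a b : ℝ} (ha : 0 ≤ a) (hb : 0 ≤ b) :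
    negMulLog (a + b) + (a * vecEntropy P + b * vecEntropy Q) ≤ vecEntropy (a • P + b • Q) := by
  rcases (add_nonneg ha hb).eq_or_lt with h0 | h0
  · have ha' : a = 0 := by linarith
    have hb' : b = 0 := by linarith
    simp [ha', hb', vecEntropy]
  set r := a + b with hr
  have hS : (a / r) • P + (b / r) • Q ∈ stdSimplex ℝ G :=
    convex_stdSimplex ℝ G hP hQ (by positivity) (by positivity) (by field_simp; exact hr.symm)
  have e : a • P + b • Q = r • ((a / r) • P + (b / r) • Q) := by
    rw [smul_add, smul_smul, smul_smul, mul_div_cancel₀ _ h0.ne', mul_div_cancel₀ _ h0.ne']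
  have hc : a / r * vecEntropy P + b / r * vecEntropy Q ≤
      vecEntropy ((a / r) • P + (b / r) • Q) := by
    rw [vecEntropy, vecEntropy, vecEntropy, Finset.mul_sum, Finset.mul_sum,
      ← Finset.sum_add_distrib]
    exact Finset.sum_le_sum fun g _ => concaveOn_negMulLog.2 (hP.1 g) (hQ.1 g)
      (by positivity) (by positivity) (by field_simp; exact hr.symm)
  rw [e, vecEntropy_smul hS]
  have := mul_le_mul_of_nonneg_left hc h0.le
  have e2 : r * (a / r * vecEntropy P + b / r * vecEntropy Q) =
      a * vecEntropy P + b * vecEntropy Q := by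
    field_simp
  linarith

/-- A nonnegative vector supported on a nonempty set is a multiple of a probability vector
supported on that set. -/
lemma exists_smul_eq_of_support {r : G → ℝ} (hr : ∀ g, 0 ≤ r g) {A : G → Prop} {a : G} (ha : A a)
    (hA : ∀ g, r g ≠ 0 → A g) :
    ∃ P ∈ stdSimplex ℝ G, (∀ g, P g ≠ 0 → A g) ∧ r = (∑ g, r g) • P := by
  classical
  rcases (Finset.sum_nonneg fun g _ => hr g).eq_or_lt with h | h
  · refine ⟨Pi.single a 1, single_mem_stdSimplex ℝ a, fun g hg => ?_, ?_⟩
    · by_cases hga : g = a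
      · exact hga ▸ ha
      · simp [hga] at hg
    · rw [← h, zero_smul]
      funext g
      exact (Finset.sum_eq_zero_iff_of_nonneg fun g _ => hr g).1 h.symm g (Finset.mem_univ g)
  · refine ⟨(∑ g, r g)⁻¹ • r, ⟨fun g => ?_, ?_⟩, fun g hg => hA g fun h0 => ?_, ?_⟩
    · exact mul_nonneg (inv_nonneg.2 h.le) (hr g)
    · simp only [Pi.smul_apply, smul_eq_mul, ← Finset.mul_sum]
      exact inv_mul_cancel₀ h.ne'
    · simp [h0] at hg
    · rw [smul_smul, mul_inv_cancel₀ h.ne', one_smul]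

/-- Conditioning a distribution on the two parts of a partition of its support. -/
lemma exists_mix_of_support {p : G → ℝ} (hp : p ∈ stdSimplex ℝ G) {A B : G → Prop} {a b : G}
    (ha : A a) (hb : B b) (h : ∀ g, p g ≠ 0 → A g ∨ B g) :
    ∃ m ∈ Icc (0 : ℝ) 1, ∃ P ∈ stdSimplex ℝ G, ∃ Q ∈ stdSimplex ℝ G,
      (∀ g, P g ≠ 0 → A g) ∧ (∀ g, Q g ≠ 0 → B g) ∧ p = (1 - m) • P + m • Q := by
  classical
  obtain ⟨P, hP, hPA, eP⟩ := exists_smul_eq_of_support (r := fun g => if A g then p g else 0)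
    (fun g => by split_ifs; exacts [hp.1 g, le_rfl]) ha (fun g hg => by_contra fun hn => by
      simp [hn] at hg)
  obtain ⟨Q, hQ, hQB, eQ⟩ := exists_smul_eq_of_support (r := fun g => if A g then 0 else p g)
    (fun g => by split_ifs; exacts [le_rfl, hp.1 g]) hb (fun g hg => by
      by_cases hA : A g
      · simp [hA] at hg
      · simp only [hA, if_false] at hg
        exact (h g hg).resolve_left hA)
  have hadd : (fun g => if A g then p g else 0) + (fun g => if A g then 0 else p g) = p := by
    funext g
    by_cases hA : A g <;> simp [hA]
  have hsum : (∑ g, if A g then p g else 0) + (∑ g, if A g then 0 else p g) = 1 := by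
    rw [← Finset.sum_add_distrib, ← hp.2]
    exact Finset.sum_congr rfl fun g _ => congrFun hadd g
  have n1 : 0 ≤ ∑ g, if A g then p g else 0 :=
    Finset.sum_nonneg fun g _ => by split_ifs; exacts [hp.1 g, le_rfl]
  have n2 : 0 ≤ ∑ g, if A g then 0 else p g :=
    Finset.sum_nonneg fun g _ => by split_ifs; exacts [le_rfl, hp.1 g]
  refine ⟨∑ g, if A g then 0 else p g, ⟨n2, by linarith⟩, P, hP, Q, hQ, hPA, hQB, ?_⟩
  rw [← eQ, ← eq_sub_of_add_eq hsum, ← eP, hadd]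

variable [AddCommGroup G]

/-- The convolution of two vectors, which is the law of the sum of independent variables. -/
def conv (p q : G → ℝ) : G → ℝ := fun g => ∑ h, p h * q (g - h)

lemma conv_comm (p q : G → ℝ) : conv p q = conv q p := by
  funext g
  refine Fintype.sum_equiv (Equiv.subLeft g) _ _ fun h => ?_
  simp [mul_comm]

lemma conv_mix_left (a b : ℝ) (p p' q : G → ℝ) :
    conv (a • p + b • p') q = a • conv p q + b • conv p' q := by
  funext g
  simp only [conv, Pi.add_apply, Pi.smul_apply, smul_eq_mul, add_mul, Finset.sum_add_distrib,
    Finset.mul_sum, mul_assoc]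

lemma conv_mix_right (a b : ℝ) (p q q' : G → ℝ) :
    conv p (a • q + b • q') = a • conv p q + b • conv p q' := by
  simp only [conv_comm p, conv_mix_left]

lemma conv_mem_stdSimplex {p q : G → ℝ} (hp : p ∈ stdSimplex ℝ G) (hq : q ∈ stdSimplex ℝ G) :
    conv p q ∈ stdSimplex ℝ G := by
  refine ⟨fun g => Finset.sum_nonneg fun h _ => mul_nonneg (hp.1 h) (hq.1 _), ?_⟩
  simp only [conv]
  rw [Finset.sum_comm]
  have : ∀ h, ∑ g, q (g - h) = 1 := fun h => by
    rw [← hq.2]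
    exact Fintype.sum_equiv (Equiv.subRight h) _ _ fun g => rfl
  simp only [← Finset.mul_sum, this, mul_one, hp.2]

lemma conv_support {p q : G → ℝ} {K : AddSubgroup G} {z w : G} (hp : ∀ g, p g ≠ 0 → g - z ∈ K)
    (hq : ∀ g, q g ≠ 0 → g - w ∈ K) : ∀ g, conv p q g ≠ 0 → g - (z + w) ∈ K := by
  intro g hg
  obtain ⟨h, -, hh⟩ := Finset.exists_ne_zero_of_sum_ne_zero hg
  have h1 := hp h (left_ne_zero_of_mul hh)
  have h2 := hq _ (right_ne_zero_of_mul hh)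
  have e : g - (z + w) = (h - z) + (g - h - w) := by abel
  exact e ▸ K.add_mem h1 h2

end Vectors

/-! ### Chains of subgroups and the lower bound -/

/-- A chain `⊥ = K 0 ≤ K 1 ≤ ⋯ ≤ K n = ⊤` of subgroups in which every step has index two, with a
representative `c i` of the nontrivial coset of `K i` in `K (i + 1)`. -/
structure DyadicChain (G : Type u) [AddCommGroup G] (n : ℕ) where
  /-- The subgroups of the chain; only those with index at most `n` matter. -/
  K : ℕ → AddSubgroup G
  /-- The coset representatives; only those with index less than `n` matter. -/
  c : ℕ → G
  zero : K 0 = ⊥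
  top : K n = ⊤
  card : ∀ i ≤ n, Nat.card (K i) = 2 ^ i
  le_succ : ∀ i < n, K i ≤ K (i + 1)
  c_mem : ∀ i < n, c i ∈ K (i + 1)
  c_notMem : ∀ i < n, c i ∉ K i
  mem_or : ∀ i < n, ∀ g ∈ K (i + 1), g ∈ K i ∨ g - c i ∈ K i

lemma exists_addSubgroup_card_two_pow_succ {G : Type u} [AddCommGroup G] [Finite G] {i : ℕ}
    (hdvd : 2 ^ (i + 1) ∣ Nat.card G) {H : AddSubgroup G} (hH : Nat.card H = 2 ^ i) :
    ∃ K : AddSubgroup G, Nat.card K = 2 ^ (i + 1) ∧ H ≤ K := by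
  obtain ⟨K, hK, hle⟩ := Sylow.exists_subgroup_card_pow_succ (G := Multiplicative G) (p := 2)
    hdvd (H := AddSubgroup.toSubgroup H) hH
  exact ⟨Subgroup.toAddSubgroup' K, hK, hle⟩

lemma nonempty_dyadicChain {G : Type u} [AddCommGroup G] [Finite G] {n : ℕ}
    (hG : Nat.card G = 2 ^ n) : Nonempty (DyadicChain G n) := by
  have step : ∀ (i : ℕ) (H : AddSubgroup G), ∃ K : AddSubgroup G,
      i < n → Nat.card H = 2 ^ i → Nat.card K = 2 ^ (i + 1) ∧ H ≤ K := by
    intro i H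
    by_cases h : i < n ∧ Nat.card H = 2 ^ i
    · obtain ⟨K, hK⟩ := exists_addSubgroup_card_two_pow_succ
        (hG ▸ pow_dvd_pow 2 (Nat.succ_le_of_lt h.1)) h.2
      exact ⟨K, fun _ _ => hK⟩
    · exact ⟨H, fun h1 h2 => absurd ⟨h1, h2⟩ h⟩
  choose next hnext using step
  let K : ℕ → AddSubgroup G := fun i => Nat.rec (motive := fun _ => AddSubgroup G) ⊥ next i
  have hcard : ∀ i ≤ n, Nat.card (K i) = 2 ^ i := by
    intro i
    induction i with
    | zero => intro _; simp [K]
    | succ i ih => intro h; exact (hnext i (K i) h (ih (by omega))).1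
  have hle : ∀ i < n, K i ≤ K (i + 1) := fun i h => (hnext i (K i) h (hcard i h.le)).2
  have hc : ∀ i, ∃ c, i < n → c ∈ K (i + 1) ∧ c ∉ K i ∧
      ∀ g ∈ K (i + 1), g ∈ K i ∨ g - c ∈ K i := by
    intro i
    by_cases h : i < n
    · have hrel : (K i).relIndex (K (i + 1)) = 2 := by
        have h1 := AddSubgroup.relIndex_mul_relIndex ⊥ (K i) (K (i + 1)) bot_le (hle i h)
        rw [AddSubgroup.relIndex_bot_left, AddSubgroup.relIndex_bot_left, hcard i h.le,
          hcard (i + 1) h, pow_succ] at h1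
        exact Nat.eq_of_mul_eq_mul_left (by positivity) h1
      obtain ⟨a, ha, hna, hor⟩ := AddSubgroup.relIndex_eq_two_iff_exists_notMem_and.1 hrel
      refine ⟨-a, fun _ => ⟨neg_mem ha, fun hm => hna (neg_mem_iff.1 hm), fun g hg => ?_⟩⟩
      rw [sub_neg_eq_add]
      exact (hor g hg).symm
    · exact ⟨0, fun h' => absurd h' h⟩
  choose c hc using hc
  exact ⟨{ K := K, c := c, zero := rfl
           top := AddSubgroup.eq_top_of_card_eq _ (by rw [hcard n le_rfl, hG])
           card := hcard, le_succ := hle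
           c_mem := fun i h => (hc i h).1
           c_notMem := fun i h => (hc i h).2.1
           mem_or := fun i h => (hc i h).2.2 }⟩

namespace DyadicChain

variable {G : Type u} [AddCommGroup G] {n : ℕ} (C : DyadicChain G n)

lemma c_add_c_mem {i : ℕ} (h : i < n) : C.c i + C.c i ∈ C.K i := by
  rcases C.mem_or i h _ (add_mem (C.c_mem i h) (C.c_mem i h)) with h1 | h1
  · exact h1
  · rw [add_sub_cancel_right] at h1
    exact absurd h1 (C.c_notMem i h)

lemma le {i j : ℕ} (hij : i ≤ j) (hj : j ≤ n) : C.K i ≤ C.K j := by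
  induction j, hij using Nat.le_induction with
  | base => exact le_rfl
  | succ j _ ih => exact (ih (by omega)).trans (C.le_succ j (by omega))

variable [Fintype G]

/-- Splitting both summands along the cosets of `K i` in `K (i + 1)` reduces the bound for
`K (i + 1)` to the one for `K i`. -/
lemma dyadicSum_le_vecEntropy_conv_of_support : ∀ i ≤ n, ∀ (z w : G) {p q : G → ℝ},
    p ∈ stdSimplex ℝ G → q ∈ stdSimplex ℝ G → (∀ g, p g ≠ 0 → g - z ∈ C.K i) →
    (∀ g, q g ≠ 0 → g - w ∈ C.K i) →
    dyadicSum (vecEntropy p) (vecEntropy q) ≤ vecEntropy (conv p q) := by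
  intro i
  induction i with
  | zero =>
    intro _ z w p q hp hq hpz hqw
    simp only [C.zero, AddSubgroup.mem_bot, sub_eq_zero] at hpz hqw
    rw [vecEntropy_eq_zero_of_support hp z hpz, vecEntropy_eq_zero_of_support hq w hqw,
      dyadicSum_of_le_of_le (k := 0) (by simp) (by simp)]
    exact vecEntropy_nonneg (conv_mem_stdSimplex hp hq)
  | succ i ih =>
    intro hi z w p q hp hq hpz hqw
    have hin : i < n := hi
    have hi' : i ≤ n := hin.le
    have split : ∀ (z : G) {p : G → ℝ}, p ∈ stdSimplex ℝ G → (∀ g, p g ≠ 0 → g - z ∈ C.K (i + 1)) →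
        ∃ m ∈ Icc (0 : ℝ) 1, ∃ P ∈ stdSimplex ℝ G, ∃ Q ∈ stdSimplex ℝ G,
          (∀ g, P g ≠ 0 → g - z ∈ C.K i) ∧ (∀ g, Q g ≠ 0 → g - (z + C.c i) ∈ C.K i) ∧
          p = (1 - m) • P + m • Q := by
      intro z p hp hpz
      refine exists_mix_of_support (A := fun g => g - z ∈ C.K i)
        (B := fun g => g - (z + C.c i) ∈ C.K i) (a := z) (b := z + C.c i) hp (by simp) (by simp)
        fun g hg => ?_
      rw [← sub_sub]
      exact C.mem_or i hin _ (hpz g hg)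
    -- Two vectors supported on the two different cosets of `K i` have disjoint supports.
    have disj : ∀ (z : G) {P Q : G → ℝ}, (∀ g, P g ≠ 0 → g - z ∈ C.K i) →
        (∀ g, Q g ≠ 0 → g - (z + C.c i) ∈ C.K i) → ∀ g, P g = 0 ∨ Q g = 0 := by
      intro z P Q hP hQ g
      by_contra! h
      have := sub_mem (hP g h.1) (hQ g h.2)
      rw [show g - z - (g - (z + C.c i)) = C.c i by abel] at this
      exact C.c_notMem i hin this
    obtain ⟨m, hm, P₀, hP₀, P₁, hP₁, sP₀, sP₁, rfl⟩ := split z hp hpz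
    obtain ⟨l, hl, Q₀, hQ₀, Q₁, hQ₁, sQ₀, sQ₁, rfl⟩ := split w hq hqw
    have i00 := ih hi' z w hP₀ hQ₀ sP₀ sQ₀
    have i01 := ih hi' z (w + C.c i) hP₀ hQ₁ sP₀ sQ₁
    have i10 := ih hi' (z + C.c i) w hP₁ hQ₀ sP₁ sQ₀
    have i11 := ih hi' (z + C.c i) (w + C.c i) hP₁ hQ₁ sP₁ sQ₁
    have s00 := conv_support sP₀ sQ₀
    have s01 := conv_support sP₀ sQ₁
    have s10 := conv_support sP₁ sQ₀
    have s11 := conv_support sP₁ sQ₁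
    have hm' : 0 ≤ 1 - m := sub_nonneg.2 hm.2
    have hl' : 0 ≤ 1 - l := sub_nonneg.2 hl.2
    have w00 := mul_nonneg hm' hl'
    have w01 := mul_nonneg hm' hl.1
    have w10 := mul_nonneg hm.1 hl'
    have w11 := mul_nonneg hm.1 hl.1
    have econv : conv ((1 - m) • P₀ + m • P₁) ((1 - l) • Q₀ + l • Q₁) =
        (((1 - m) * (1 - l)) • conv P₀ Q₀ + (m * l) • conv P₁ Q₁) +
          (((1 - m) * l) • conv P₀ Q₁ + (m * (1 - l)) • conv P₁ Q₀) := by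
      funext g
      simp only [conv_mix_left, conv_mix_right, Pi.add_apply, Pi.smul_apply, smul_eq_mul]
      ring
    rw [econv, vecEntropy_mix_of_disjoint hP₀ hP₁ (disj z sP₀ sP₁),
      vecEntropy_mix_of_disjoint hQ₀ hQ₁ (disj w sQ₀ sQ₁), vecEntropy_add_of_disjoint]
    · have e0 := le_vecEntropy_mix (conv_mem_stdSimplex hP₀ hQ₀) (conv_mem_stdSimplex hP₁ hQ₁)
        w00 w11
      have e1 := le_vecEntropy_mix (conv_mem_stdSimplex hP₀ hQ₁) (conv_mem_stdSimplex hP₁ hQ₀)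
        w01 w10
      have hb := binarySum_binEntropy hm hl
      rw [binEntropy_eq_negMulLog_add_negMulLog_one_sub (m * (1 - l) + l * (1 - m)),
        show m * (1 - l) + l * (1 - m) = (1 - m) * l + m * (1 - l) by ring,
        show 1 - ((1 - m) * l + m * (1 - l)) = (1 - m) * (1 - l) + m * l by ring] at hb
      have hj := dyadicSum_jensen hm hl (vecEntropy P₀) (vecEntropy P₁) (vecEntropy Q₀)
        (vecEntropy Q₁)
      have hs := dyadicSum_add_le (a := binEntropy m) (b := binEntropy l)
        ⟨binEntropy_nonneg hm.1 hm.2, binEntropy_le_log_two⟩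
        ⟨binEntropy_nonneg hl.1 hl.2, binEntropy_le_log_two⟩
        ((1 - m) * vecEntropy P₀ + m * vecEntropy P₁)
        ((1 - l) * vecEntropy Q₀ + l * vecEntropy Q₁)
      have j00 := mul_le_mul_of_nonneg_left i00 w00
      have j01 := mul_le_mul_of_nonneg_left i01 w01
      have j10 := mul_le_mul_of_nonneg_left i10 w10
      have j11 := mul_le_mul_of_nonneg_left i11 w11
      linarith
    · refine disj (z + w) ?_ ?_ <;> intro g hg
      · by_cases h : conv P₀ Q₀ g = 0
        · have h' : conv P₁ Q₁ g ≠ 0 := fun h' => by simp [h, h'] at hg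
          have := add_mem (s11 g h') (C.c_add_c_mem hin)
          rwa [show g - (z + C.c i + (w + C.c i)) + (C.c i + C.c i) = g - (z + w) by abel] at this
        · exact s00 g h
      · by_cases h : conv P₀ Q₁ g = 0
        · have h' : conv P₁ Q₀ g ≠ 0 := fun h' => by simp [h, h'] at hg
          have := s10 g h'
          rwa [add_right_comm] at this
        · have := s01 g h
          rwa [← add_assoc] at this

/-- The lower bound for the entropy of a sum of two independent variables. -/
lemma dyadicSum_le_vecEntropy_conv (C : DyadicChain G n) {p q : G → ℝ} (hp : p ∈ stdSimplex ℝ G)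
    (hq : q ∈ stdSimplex ℝ G) :
    dyadicSum (vecEntropy p) (vecEntropy q) ≤ vecEntropy (conv p q) :=
  C.dyadicSum_le_vecEntropy_conv_of_support n le_rfl 0 0 hp hq (by simp [C.top]) (by simp [C.top])

end DyadicChain

/-! ### The extremal distributions -/

section Shift

variable {G : Type u} [AddCommGroup G]

/-- The translate of `p` by `a`. -/
def shift (a : G) (p : G → ℝ) : G → ℝ := fun g => p (g - a)

lemma shift_shift (a b : G) (p : G → ℝ) : shift a (shift b p) = shift (a + b) p := by
  funext g
  simp only [shift, sub_sub]

lemma shift_mix (a : G) (x y : ℝ) (p q : G → ℝ) :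
    shift a (x • p + y • q) = x • shift a p + y • shift a q := rfl

variable [Fintype G]

lemma shift_mem_stdSimplex {p : G → ℝ} (hp : p ∈ stdSimplex ℝ G) (a : G) :
    shift a p ∈ stdSimplex ℝ G :=
  ⟨fun _ => hp.1 _, hp.2 ▸ Fintype.sum_equiv (Equiv.subRight a) _ _ fun _ => rfl⟩

lemma vecEntropy_shift (a : G) (p : G → ℝ) : vecEntropy (shift a p) = vecEntropy p :=
  Fintype.sum_equiv (Equiv.subRight a) _ _ fun _ => rfl

lemma conv_shift_right (a : G) (p q : G → ℝ) : conv p (shift a q) = shift a (conv p q) := by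
  funext g
  simp only [conv, shift]
  exact Finset.sum_congr rfl fun h _ => by rw [sub_right_comm]

lemma conv_shift_left (a : G) (p q : G → ℝ) : conv (shift a p) q = shift a (conv p q) := by
  rw [conv_comm, conv_shift_right, conv_comm]

end Shift

namespace DyadicChain

variable {G : Type u} [AddCommGroup G] {n : ℕ} (C : DyadicChain G n)

open Classical in
/-- The uniform distribution on the subgroup `K k` of order `2 ^ k`. -/
noncomputable def unif (k : ℕ) : G → ℝ := fun g => if g ∈ C.K k then ((2 : ℝ) ^ k)⁻¹ else 0

/-- The distribution of a uniform element of `K k` plus an independent multiple `0` or `c k` of the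
coset representative, where `c k` has probability `m`. -/
noncomputable def extremal (k : ℕ) (m : ℝ) : G → ℝ :=
  (1 - m) • C.unif k + m • shift (C.c k) (C.unif k)

/-- The laws `extremal k m` with `k < n`, together with the uniform law on the whole group: as
`c n` has no meaning, `k = n` is only allowed with `m = 0`. -/
def extremalLaws : Set (G → ℝ) :=
  {p | ∃ k ≤ n, ∃ m ∈ Icc (0 : ℝ) 1, (k = n → m = 0) ∧ p = C.extremal k m}

variable {k j : ℕ}

lemma mem_of_unif_ne_zero {g : G} (h : C.unif k g ≠ 0) : g ∈ C.K k := by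
  by_contra hg
  simp [unif, hg] at h

lemma shift_unif_of_mem {a : G} (ha : a ∈ C.K k) : shift a (C.unif k) = C.unif k := by
  funext g
  have h : g - a ∈ C.K k ↔ g ∈ C.K k := by
    rw [sub_eq_add_neg, add_mem_cancel_right (neg_mem ha)]
  by_cases hg : g ∈ C.K k <;> simp [shift, unif, h, hg]

lemma extremal_support (hj : j < n) {m : ℝ} {g : G} (hg : C.extremal j m g ≠ 0) :
    g ∈ C.K (j + 1) := by
  by_cases h : C.unif j g = 0
  · have h' : C.unif j (g - C.c j) ≠ 0 := fun h' => by simp [extremal, shift, h, h'] at hg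
    have := add_mem (C.le_succ j hj (C.mem_of_unif_ne_zero h')) (C.c_mem j hj)
    rwa [sub_add_cancel] at this
  · exact C.le_succ j hj (C.mem_of_unif_ne_zero h)

variable [Fintype G]

lemma unif_sum_eq (hk : k ≤ n) (f : ℝ → ℝ) (hf : f 0 = 0) :
    ∑ g, f (C.unif k g) = 2 ^ k * f ((2 : ℝ) ^ k)⁻¹ := by
  classical
  have h1 : ∀ g, f (C.unif k g) = if g ∈ C.K k then f ((2 : ℝ) ^ k)⁻¹ else 0 := by
    intro g
    unfold unif
    split_ifs <;> simp [hf]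
  have hc := C.card k hk
  rw [Nat.card_eq_fintype_card, Fintype.card_subtype] at hc
  simp only [h1, ← Finset.sum_filter, Finset.sum_const, nsmul_eq_mul]
  have : ((Finset.univ.filter fun g => g ∈ C.K k).card : ℝ) = 2 ^ k := by exact_mod_cast hc
  rw [← this]

lemma unif_mem_stdSimplex (hk : k ≤ n) : C.unif k ∈ stdSimplex ℝ G := by
  refine ⟨fun g => ?_, ?_⟩
  · unfold unif
    split_ifs <;> positivity
  · have := C.unif_sum_eq hk id rfl
    simp only [id] at this
    rw [this, mul_inv_cancel₀ (by positivity)]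

lemma vecEntropy_unif (hk : k ≤ n) : vecEntropy (C.unif k) = k * log 2 := by
  rw [vecEntropy, C.unif_sum_eq hk negMulLog negMulLog_zero, negMulLog, log_inv, log_pow]
  field_simp

lemma conv_unif_of_support {p : G → ℝ} (hp : p ∈ stdSimplex ℝ G)
    (h : ∀ g, p g ≠ 0 → g ∈ C.K k) : conv p (C.unif k) = C.unif k := by
  funext g
  have : ∀ x, p x * C.unif k (g - x) = p x * C.unif k g := by
    intro x
    by_cases hx : p x = 0
    · rw [hx, zero_mul, zero_mul]
    · rw [← congrFun (C.shift_unif_of_mem (h x hx)) g, shift]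
  simp only [conv, this, ← Finset.sum_mul, hp.2, one_mul]

lemma extremal_mem_stdSimplex (hk : k ≤ n) {m : ℝ} (hm : m ∈ Icc (0 : ℝ) 1) :
    C.extremal k m ∈ stdSimplex ℝ G :=
  convex_stdSimplex ℝ G (C.unif_mem_stdSimplex hk)
    (shift_mem_stdSimplex (C.unif_mem_stdSimplex hk) _) (sub_nonneg.2 hm.2) hm.1 (by ring)

lemma vecEntropy_extremal (hk : k ≤ n) {m : ℝ} (hkm : k = n → m = 0) :
    vecEntropy (C.extremal k m) = k * log 2 + binEntropy m := by
  rcases hk.eq_or_lt with h | h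
  · simp [extremal, hkm h, C.vecEntropy_unif hk]
  · have hu := C.unif_mem_stdSimplex hk
    rw [extremal, vecEntropy_mix_of_disjoint hu (shift_mem_stdSimplex hu _), vecEntropy_shift,
      C.vecEntropy_unif hk]
    · ring
    · intro g
      by_contra! hg
      have h1 := C.mem_of_unif_ne_zero hg.1
      have h2 := sub_mem h1 (C.mem_of_unif_ne_zero hg.2)
      rw [sub_sub_cancel] at h2
      exact C.c_notMem k h h2

lemma conv_extremal_of_lt (hjk : j < k) (hk : k ≤ n) {m : ℝ} (hm : m ∈ Icc (0 : ℝ) 1) (l : ℝ) :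
    conv (C.extremal j m) (C.extremal k l) = C.extremal k l := by
  have h := C.conv_unif_of_support (k := k) (C.extremal_mem_stdSimplex (hjk.le.trans hk) hm)
    fun g hg => C.le hjk hk (C.extremal_support (hjk.trans_le hk) hg)
  rw [extremal.eq_1 C k, conv_mix_right, conv_shift_right, h]

lemma conv_extremal_self (hk : k < n) (m l : ℝ) :
    conv (C.extremal k m) (C.extremal k l) = C.extremal k (m * (1 - l) + l * (1 - m)) := by
  have h := C.conv_unif_of_support (C.unif_mem_stdSimplex hk.le) fun g => C.mem_of_unif_ne_zero
  simp only [extremal, conv_mix_left, conv_mix_right, conv_shift_left, conv_shift_right, h,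
    shift_mix, shift_shift, C.shift_unif_of_mem (C.c_add_c_mem hk)]
  funext g
  simp only [Pi.add_apply, Pi.smul_apply, smul_eq_mul]
  ring

lemma binaryConv_mem_Icc {m l : ℝ} (hm : m ∈ Icc (0 : ℝ) 1) (hl : l ∈ Icc (0 : ℝ) 1) :
    m * (1 - l) + l * (1 - m) ∈ Icc (0 : ℝ) 1 := by
  have h1 := mul_nonneg hm.1 (sub_nonneg.2 hl.2)
  have h2 := mul_nonneg hl.1 (sub_nonneg.2 hm.2)
  have h3 := mul_nonneg (sub_nonneg.2 hm.2) (sub_nonneg.2 hl.2)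
  have h4 := mul_nonneg hm.1 hl.1
  constructor <;> linarith

lemma mem_stdSimplex_of_mem_extremalLaws {p : G → ℝ} (hp : p ∈ C.extremalLaws) :
    p ∈ stdSimplex ℝ G := by
  obtain ⟨k, hk, m, hm, -, rfl⟩ := hp
  exact C.extremal_mem_stdSimplex hk hm

lemma vecEntropy_le_of_mem_extremalLaws {p : G → ℝ} (hp : p ∈ C.extremalLaws) :
    vecEntropy p ≤ n * log 2 := by
  obtain ⟨k, hk, m, hm, hkm, rfl⟩ := hp
  rw [C.vecEntropy_extremal hk hkm]
  rcases hk.eq_or_lt with rfl | h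
  · simp [hkm rfl]
  · have : (k : ℝ) + 1 ≤ n := by exact_mod_cast h
    have := mul_le_mul_of_nonneg_right this log_two_pos.le
    linarith [binEntropy_le_log_two (p := m)]

lemma exists_mem_extremalLaws {x : ℝ} (hx : x ∈ Icc 0 (n * log 2)) :
    ∃ p ∈ C.extremalLaws, vecEntropy p = x := by
  have hL := log_two_pos
  set k := ⌊x / log 2⌋₊ with hk
  have h1 : k * log 2 ≤ x := (le_div_iff₀ hL).1 (Nat.floor_le (div_nonneg hx.1 hL.le))
  have h2 : x < (k + 1) * log 2 := (div_lt_iff₀ hL).1 (Nat.lt_floor_add_one _)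
  have hkn : k ≤ n := by
    have : (k : ℝ) ≤ n := le_of_mul_le_mul_right (h1.trans hx.2) hL
    exact_mod_cast this
  rcases hkn.eq_or_lt with h | h
  · refine ⟨C.extremal k 0, ⟨k, hkn, 0, by simp, fun _ => rfl, rfl⟩, ?_⟩
    rw [C.vecEntropy_extremal hkn fun _ => rfl, binEntropy_zero, add_zero]
    exact le_antisymm h1 (h ▸ hx.2)
  · obtain ⟨α, hα, e⟩ := exists_biasEntropy_eq (sub_nonneg.2 h1) (by linarith)
    refine ⟨C.extremal k ((1 - α) / 2), ⟨k, hkn, _, ⟨by linarith [hα.2], by linarith [hα.1]⟩,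
      fun h' => absurd h' h.ne, rfl⟩, ?_⟩
    rw [C.vecEntropy_extremal hkn fun h' => absurd h' h.ne]
    rw [biasEntropy] at e
    linarith

/-- The extremal laws are closed under convolution, and they attain the lower bound. -/
lemma conv_mem_extremalLaws {p q : G → ℝ} (hp : p ∈ C.extremalLaws) (hq : q ∈ C.extremalLaws) :
    conv p q ∈ C.extremalLaws ∧
      vecEntropy (conv p q) = dyadicSum (vecEntropy p) (vecEntropy q) := by
  obtain ⟨j, hj, m, hm, hjm, rfl⟩ := hp
  obtain ⟨k, hk, l, hl, hkl, rfl⟩ := hq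
  have hL := log_two_pos
  have lt_case : ∀ {j k : ℕ} {m l : ℝ}, j < k → k ≤ n → m ∈ Icc (0 : ℝ) 1 → l ∈ Icc (0 : ℝ) 1 →
      (j = n → m = 0) → (k = n → l = 0) →
      dyadicSum (vecEntropy (C.extremal j m)) (vecEntropy (C.extremal k l)) =
        vecEntropy (C.extremal k l) := by
    intro j k m l hjk hk hm hl hjm hkl
    rw [C.vecEntropy_extremal (hjk.le.trans hk) hjm, C.vecEntropy_extremal hk hkl]
    refine dyadicSum_of_le_of_le (k := k) ?_ ?_
    · have : (j : ℝ) + 1 ≤ k := by exact_mod_cast hjk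
      have := mul_le_mul_of_nonneg_right this hL.le
      push_cast
      linarith [binEntropy_le_log_two (p := m)]
    · push_cast
      linarith [binEntropy_nonneg hl.1 hl.2]
  rcases lt_trichotomy j k with h | rfl | h
  · rw [C.conv_extremal_of_lt h hk hm]
    exact ⟨⟨k, hk, l, hl, hkl, rfl⟩, (lt_case h hk hm hl hjm hkl).symm⟩
  · have hconv : conv (C.extremal j m) (C.extremal j l) =
        C.extremal j (m * (1 - l) + l * (1 - m)) := by
      rcases hk.eq_or_lt with h | h
      · have := C.conv_unif_of_support (C.unif_mem_stdSimplex hk) fun g => C.mem_of_unif_ne_zero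
        simp [hjm h, hkl h, extremal, this]
      · exact C.conv_extremal_self h m l
    have hjr : j = n → m * (1 - l) + l * (1 - m) = 0 := fun h => by simp [hjm h, hkl h]
    rw [hconv]
    refine ⟨⟨j, hj, _, binaryConv_mem_Icc hm hl, hjr, rfl⟩, ?_⟩
    have m0 := binEntropy_nonneg hm.1 hm.2
    have l0 := binEntropy_nonneg hl.1 hl.2
    have m1 := binEntropy_le_log_two (p := m)
    have l1 := binEntropy_le_log_two (p := l)
    rw [C.vecEntropy_extremal hj hjm, C.vecEntropy_extremal hj hkl, C.vecEntropy_extremal hj hjr,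
      dyadicSum_of_mem_block (k := j) (by push_cast; linarith) (by push_cast; linarith)
        (by push_cast; linarith) (by push_cast; linarith)]
    push_cast
    rw [add_sub_cancel_left, add_sub_cancel_left, binarySum_binEntropy hm hl]
  · rw [conv_comm, dyadicSum_comm, C.conv_extremal_of_lt h hj hl]
    exact ⟨⟨j, hj, m, hm, hjm, rfl⟩, (lt_case h hj hl hm hkl hjm).symm⟩

end DyadicChain

/-! ### Laws of sums of independent variables -/

section Law

variable {G : Type u} [Fintype G] {Ω : Type v} [MeasurableSpace Ω]

/-- The vector of point masses of the law of `X`. -/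
noncomputable def law (μ : Measure Ω) (X : Ω → G) : G → ℝ := fun g => μ.real (X ⁻¹' {g})

lemma vecEntropy_law (μ : Measure Ω) (X : Ω → G) : vecEntropy (law μ X) = shannonEntropy μ X := rfl

variable [MeasurableSpace G] [DiscreteMeasurableSpace G]

lemma law_mem_stdSimplex (μ : Measure Ω) [IsProbabilityMeasure μ] {X : Ω → G}
    (hX : Measurable X) : law μ X ∈ stdSimplex ℝ G := by
  refine ⟨fun g => measureReal_nonneg, ?_⟩
  have h := measureReal_biUnion_finset (μ := μ) (s := Finset.univ) (f := fun g => X ⁻¹' {g})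
    (fun a _ b _ hab => (disjoint_singleton.2 hab).preimage X)
    (fun g _ => hX (measurableSet_singleton g))
  have hU : ⋃ g ∈ (Finset.univ : Finset G), X ⁻¹' {g} = univ := by
    ext ω
    simp
  rw [hU, probReal_univ] at h
  exact h.symm

lemma law_add [AddCommGroup G] (μ : Measure Ω) [IsProbabilityMeasure μ] {X Y : Ω → G}
    (hX : Measurable X) (hY : Measurable Y) (h : IndepFun X Y μ) :
    law μ (fun ω => X ω + Y ω) = conv (law μ X) (law μ Y) := by
  funext g
  have hU : (fun ω => X ω + Y ω) ⁻¹' {g} =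
      ⋃ a ∈ (Finset.univ : Finset G), X ⁻¹' {a} ∩ Y ⁻¹' {g - a} := by
    ext ω
    simp [eq_sub_iff_add_eq, add_comm]
  rw [law, hU, measureReal_biUnion_finset]
  · refine Finset.sum_congr rfl fun a _ => ?_
    rw [measureReal_def, h.measure_inter_preimage_eq_mul _ _ (measurableSet_singleton a)
      (measurableSet_singleton (g - a)), ENNReal.toReal_mul]
    rfl
  · intro a _ b _ hab
    exact ((disjoint_singleton.2 hab).preimage X).mono inter_subset_left inter_subset_left
  · exact fun a _ => (hX (measurableSet_singleton a)).inter (hY (measurableSet_singleton _))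

lemma law_sum_succ [AddCommGroup G] (μ : Measure Ω) [IsProbabilityMeasure μ] {k : ℕ}
    {X : Fin (k + 1) → Ω → G} (hX : ∀ i, Measurable (X i)) (h : iIndepFun X μ) :
    law μ (fun ω => ∑ i, X i ω) =
      conv (law μ (X 0)) (law μ (fun ω => ∑ i : Fin k, X i.succ ω)) := by
  have hmeas : Measurable fun ω => ∑ i : Fin k, X i.succ ω :=
    Finset.measurable_fun_sum _ fun i _ => hX i.succ
  have hind : IndepFun (X 0) (fun ω => ∑ i : Fin k, X i.succ ω) μ := by
    have := (h.indepFun_finsetSum_of_notMem hX (s := Finset.univ.map (Fin.succEmb k)) (i := 0)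
      (by simp [Fin.succ_ne_zero])).symm
    convert this using 1
    funext ω
    simp [Finset.sum_map]
  rw [← law_add μ (hX 0) hmeas hind]
  simp only [Fin.sum_univ_succ]

end Law

/-- Any finite family of laws on `G` is the family of laws of independent variables on a space in a
prescribed universe. -/
lemma exists_indep_of_laws {G : Type u} [Fintype G] [MeasurableSpace G]
    [DiscreteMeasurableSpace G] {k : ℕ} {p : Fin k → G → ℝ} (hp : ∀ i, p i ∈ stdSimplex ℝ G) :
    ∃ (Ω : Type v) (_ : MeasurableSpace Ω) (μ : Measure Ω) (X : Fin k → Ω → G),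
      IsProbabilityMeasure μ ∧ (∀ i, Measurable (X i)) ∧ iIndepFun X μ ∧
      ∀ i, law μ (X i) = p i := by
  -- `G` itself lives in another universe, so it is replaced by a lift of `Fin (card G)`.
  let S : Type v := ULift.{v} (Fin (Fintype.card G))
  let e : S ≃ G := Equiv.ulift.trans (Fintype.equivFin G).symm
  let _ : MeasurableSpace S := ⊤
  have hmass : ∀ i, ∑ s : S, ENNReal.ofReal (p i (e s)) = 1 := by
    intro i
    rw [← ENNReal.ofReal_sum_of_nonneg fun s _ => (hp i).1 _, Equiv.sum_comp e (p i), (hp i).2,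
      ENNReal.ofReal_one]
  let ν : Fin k → Measure S := fun i => (PMF.ofFintype _ (hmass i)).toMeasure
  have hme : Measurable e := fun _ _ => trivial
  refine ⟨Fin k → S, inferInstance, Measure.pi ν, fun i ω => e (ω i), inferInstance,
    fun i => hme.comp (measurable_pi_apply i), iIndepFun_pi fun i => hme.aemeasurable,
    fun i => ?_⟩
  funext g
  have hpre : (fun ω : Fin k → S => e (ω i)) ⁻¹' {g} =
      Function.eval i ⁻¹' ({e.symm g} : Set S) := by
    ext ω
    simp [Equiv.eq_symm_apply]
  have h1 := (measurePreserving_eval ν i).measure_preimage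
    (MeasurableSet.nullMeasurableSet (s := ({e.symm g} : Set S)) trivial)
  rw [law, hpre, measureReal_def, h1]
  simp only [ν]
  rw [PMF.toMeasure_apply_singleton _ (e.symm g)
      (show MeasurableSet ({e.symm g} : Set S) from trivial), PMF.ofFintype_apply,
    Equiv.apply_symm_apply, ENNReal.toReal_ofReal ((hp i).1 g)]

/-! ### The minimal entropy of a sum of `k` variables -/

section Main

variable {G : Type u} [AddCommGroup G] [Fintype G] {n : ℕ}

lemma nested_dyadicSum_mem_Icc (C : DyadicChain G n) (k : ℕ) {x : Fin (k + 1) → ℝ}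
    (hx : ∀ i, x i ∈ Icc (0 : ℝ) (n * log 2)) :
    nested dyadicSum (k + 1) x ∈ Icc (0 : ℝ) (n * log 2) := by
  suffices h : ∃ p ∈ C.extremalLaws, vecEntropy p = nested dyadicSum (k + 1) x by
    obtain ⟨p, hp, e⟩ := h
    rw [← e]
    exact ⟨vecEntropy_nonneg (C.mem_stdSimplex_of_mem_extremalLaws hp),
      C.vecEntropy_le_of_mem_extremalLaws hp⟩
  induction k with
  | zero => exact C.exists_mem_extremalLaws (hx 0)
  | succ k ih =>
    obtain ⟨p, hp, e⟩ := ih fun i => hx i.succ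
    obtain ⟨q, hq, e'⟩ := C.exists_mem_extremalLaws (hx 0)
    obtain ⟨h1, h2⟩ := C.conv_mem_extremalLaws hq hp
    exact ⟨_, h1, by rw [h2, e, e']; rfl⟩

variable [MeasurableSpace G] [DiscreteMeasurableSpace G]

lemma nested_dyadicSum_le (C : DyadicChain G n) {Ω : Type v} [MeasurableSpace Ω] (μ : Measure Ω)
    [IsProbabilityMeasure μ] : ∀ (k : ℕ) (X : Fin (k + 1) → Ω → G), (∀ i, Measurable (X i)) →
      iIndepFun X μ → nested dyadicSum (k + 1) (fun i => shannonEntropy μ (X i)) ≤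
        shannonEntropy μ (fun ω => ∑ i, X i ω) := by
  intro k
  induction k with
  | zero =>
    intro X _ _
    simp [nested]
  | succ k ih =>
    intro X hX h
    have hr := ih (fun i => X i.succ) (fun i => hX i.succ) (h.precomp (Fin.succ_injective _))
    have hmeas : Measurable fun ω => ∑ i : Fin (k + 1), X i.succ ω :=
      Finset.measurable_fun_sum _ fun i _ => hX i.succ
    calc nested dyadicSum (k + 2) (fun i => shannonEntropy μ (X i))
        ≤ dyadicSum (shannonEntropy μ (X 0))
            (shannonEntropy μ (fun ω => ∑ i : Fin (k + 1), X i.succ ω)) :=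
          dyadicSum_mono_right _ hr
      _ ≤ vecEntropy (conv (law μ (X 0)) (law μ (fun ω => ∑ i : Fin (k + 1), X i.succ ω))) :=
          C.dyadicSum_le_vecEntropy_conv (law_mem_stdSimplex μ (hX 0))
            (law_mem_stdSimplex μ hmeas)
      _ = shannonEntropy μ (fun ω => ∑ i, X i ω) := by
          rw [← law_sum_succ μ hX h, vecEntropy_law]

lemma shannonEntropy_sum_of_mem_extremalLaws (C : DyadicChain G n) {Ω : Type v}
    [MeasurableSpace Ω] (μ : Measure Ω) [IsProbabilityMeasure μ] :
    ∀ (k : ℕ) (X : Fin (k + 1) → Ω → G), (∀ i, Measurable (X i)) → iIndepFun X μ →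
      (∀ i, law μ (X i) ∈ C.extremalLaws) →
      law μ (fun ω => ∑ i, X i ω) ∈ C.extremalLaws ∧
        shannonEntropy μ (fun ω => ∑ i, X i ω) =
          nested dyadicSum (k + 1) (fun i => shannonEntropy μ (X i)) := by
  intro k
  induction k with
  | zero =>
    intro X _ _ hC
    simpa [nested] using hC 0
  | succ k ih =>
    intro X hX h hC
    obtain ⟨h1, h2⟩ := ih (fun i => X i.succ) (fun i => hX i.succ)
      (h.precomp (Fin.succ_injective _)) fun i => hC i.succ
    obtain ⟨h3, h4⟩ := C.conv_mem_extremalLaws (hC 0) h1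
    rw [← law_sum_succ μ hX h] at h3 h4
    refine ⟨h3, ?_⟩
    rw [← vecEntropy_law, h4, vecEntropy_law, vecEntropy_law, h2]
    rfl

lemma isLeast_nested_dyadicSum (C : DyadicChain G n) (k : ℕ) {x : Fin (k + 1) → ℝ}
    (hx : ∀ i, x i ∈ Icc (0 : ℝ) (n * log 2)) :
    IsLeast (sumEntropies.{u, v} G x) (nested dyadicSum (k + 1) x) := by
  constructor
  · choose p hp hpx using fun i => C.exists_mem_extremalLaws (hx i)
    obtain ⟨Ω, _, μ, X, hμ, hX, hind, hlaw⟩ := exists_indep_of_laws.{u, v}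
      fun i => C.mem_stdSimplex_of_mem_extremalLaws (hp i)
    have hent : ∀ i, shannonEntropy μ (X i) = x i := fun i => by
      rw [← vecEntropy_law, hlaw, hpx]
    refine ⟨Ω, _, μ, X, hμ, hX, hind, hent, ?_⟩
    rw [(shannonEntropy_sum_of_mem_extremalLaws C μ k X hX hind fun i => hlaw i ▸ hp i).2]
    simp only [hent]
  · rintro _ ⟨Ω, _, μ, X, hμ, hX, hind, hent, rfl⟩
    have := nested_dyadicSum_le C μ k X hX hind
    simpa only [hent] using this

lemma minSumEntropyTwo_eq_dyadicSum (C : DyadicChain G n) {x y : ℝ}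
    (hx : x ∈ Icc (0 : ℝ) (n * log 2)) (hy : y ∈ Icc (0 : ℝ) (n * log 2)) :
    minSumEntropyTwo.{u, v} G x y = dyadicSum x y :=
  (isLeast_nested_dyadicSum.{u, v} C 1 (x := ![x, y]) (Fin.forall_fin_two.2 ⟨hx, hy⟩)).csInf_eq

lemma nested_minSumEntropyTwo_eq (C : DyadicChain G n) (k : ℕ) {x : Fin (k + 1) → ℝ}
    (hx : ∀ i, x i ∈ Icc (0 : ℝ) (n * log 2)) :
    nested (minSumEntropyTwo.{u, v} G) (k + 1) x = nested dyadicSum (k + 1) x := by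
  induction k with
  | zero => rfl
  | succ k ih =>
    calc nested (minSumEntropyTwo.{u, v} G) (k + 2) x
        = minSumEntropyTwo.{u, v} G (x 0) (nested dyadicSum (k + 1) fun i => x i.succ) :=
          congrArg _ (ih fun i => hx i.succ)
      _ = nested dyadicSum (k + 2) x :=
          minSumEntropyTwo_eq_dyadicSum C (hx 0) (nested_dyadicSum_mem_Icc C k fun i => hx i.succ)

end Main

theorem theorem6p5 (G : Type u) [AddCommGroup G] [Fintype G]
    [MeasurableSpace G] [DiscreteMeasurableSpace G]
    (n : ℕ) (hG : Fintype.card G = 2 ^ n)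
    (k : ℕ) (hk : 2 ≤ k) (x : Fin k → ℝ)
    (hx : ∀ i, x i ∈ Set.Icc (0 : ℝ) (n * Real.log 2)) :
    IsLeast (sumEntropies.{u, v} G x) (minSumEntropy.{u, v} G x) ∧
      minSumEntropy.{u, v} G x = nested (minSumEntropyTwo.{u, v} G) k x := by
  obtain ⟨C⟩ := nonempty_dyadicChain (Nat.card_eq_fintype_card.trans hG)
  obtain ⟨k, rfl⟩ := Nat.exists_eq_add_of_le' (Nat.one_le_of_lt hk)
  have h := isLeast_nested_dyadicSum.{u, v} C k hx
  have he : minSumEntropy.{u, v} G x = nested dyadicSum (k + 1) x := h.csInf_eq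
  rw [nested_minSumEntropyTwo_eq C k hx, he]
  exact ⟨h, rfl⟩
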